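/- Let $(M,\mathcal M,m)$ be a probability space and let $f:M\to M$ be measurable and nonsingular with respect to $m$ (i.e. $f_*m\ll m$). Let $P:L^1(m)\to L^1(m)$ be the Perron–Frobenius operator, $P\varphi=\frac{d f_*(\varphi\,m)}{dm}$ (all functions are real valued). Let $|\cdot|_{\mathcal B}$ be a seminorm on $L^1(m)$ with values in $[0,\infty]$, and put $\mathcal B=\{\varphi\in L^1(m):|\varphi|_{\mathcal B}<\infty\}$ and $\|\varphi\|_{\mathcal B}=|\varphi|_{\mathcal B}+\|\varphi\|_{L^1(m)}$. Assume that $\mathcal B\neq\{0\}$ and that 1. $(\mathcal B,\|\cdot\|_{\mathcal B})$ is a Banach space; 2. the inclusion $\mathcal B\hookrightarrow L^1(m)$ is compact; 3. $P(\mathcal B)\subset\mathcal B$ and $P|_{\mathcal B}$ is bounded for $\|\cdot\|_{\mathcal B}$; 4. there are $n_0\ge1$, $0<\alpha<1$ and $\beta>0$ with $|P^{n_0}\varphi|_{\mathcal B}\le\alpha|\varphi|_{\mathcal B}+\beta\|\varphi\|_{L^1(m)}$ for all $\varphi\in\mathcal B$; 5. $\mathcal B$ is closed under multiplication, and there is $C_1>0$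 with $\|\varphi\psi\|_{\mathcal B}\le C_1\|\varphi\|_{\mathcal B}\|\psi\|_{\mathcal B}$ for all $\varphi,\psi\in\mathcal B$; 6. there is $C_2>0$ with $\|\varphi\|_{L^\infty(m)}\le C_2\|\varphi\|_{\mathcal B}$ for all $\varphi\in\mathcal B$. Call an $f$-invariant probability measure that is absolutely continuous with respect to $m$ an acip. Then $f$ has an acip whose density with respect to $m$ belongs to $\mathcal B$. Moreover, let $\mu$ be an acip for which $f$ is mixing, i.e. $\mu(A\cap f^{-n}B)\to\mu(A)\mu(B)$ for all measurable $A,B$. (a) If every acip is absolutely continuous with respect to $\mu$, then there are $C,\tau>0$ such that for all $\varphi\in\mathcal B$, $\psi\in L^1(m)$ and $n\ge0$ $$\left|\int\varphi\,(\psi\circ f^n)\,d\mu-\int\varphi\,d\mu\int\psi\circ f^n\,d\mu\right|\le C e^{-\tau n}\,\|\varphi\|_{\mathcal B}\,\|\psi\|_{L^1(m)} .$$ (b) Suppose that the density is bounded away from zero: there is $c>0$ with $d\mu/dm\ge c$ $m$-almost everywhere. Then $f$ has exponential decay of correlations for observables in $\mathcal B$ against observables in $L^1(\mu)$: there are $C,\tau>0$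 such that for all nonzero $\varphi\in\mathcal B$, all nonzero $\psi\in L^1(\mu)$ and all $n\ge0$ $$\mathrm{Cor}_\mu(\varphi,\psi\circ f^n):=\frac{1}{\|\varphi\|_{\mathcal B}\,\|\psi\circ f^n\|_{L^1(\mu)}}\left|\int\varphi\,(\psi\circ f^n)\,d\mu-\int\varphi\,d\mu\int\psi\circ f^n\,d\mu\right|\le C e^{-\tau n}.$$ Furthermore, for every $\varepsilon>0$ and every $K>0$ there are $C,\tau>0$ such that for all $\varphi\in\mathcal B$ with $\|\varphi\|_{\mathcal B}\le K$ and all $n\ge1$ $$LD_\mu(\varphi,\varepsilon,n):=\mu\left(\left|\frac1n\sum_{i=0}^{n-1}\varphi\circ f^i-\int\varphi\,d\mu\right|>\varepsilon\right)\le C e^{-\tau n}.$$ -/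

import Mathlib

open MeasureTheory Filter Topology
open scoped ENNReal

noncomputable section

/-- A seminorm on a real vector space that may take the value `∞`
(with the convention `0 * ∞ = 0`). -/
structure ExtSeminorm (E : Type*) [AddCommGroup E] [Module ℝ E] where
  toFun : E → ℝ≥0∞
  add_le' : ∀ x y, toFun (x + y) ≤ toFun x + toFun y
  smul' : ∀ (a : ℝ) (x : E), toFun (a • x) = ‖a‖ₑ * toFun x

namespace ExtSeminorm

variable {E : Type*} [NormedAddCommGroup E] [NormedSpace ℝ E]

instance : CoeFun (ExtSeminorm E) (fun _ => E → ℝ≥0∞) := ⟨ExtSeminorm.toFun⟩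

/-- The subspace of vectors of finite seminorm. -/
def finite (p : ExtSeminorm E) : Submodule ℝ E where
  carrier := {x | p x < ∞}
  add_mem' := fun {x y} hx hy => (p.add_le' x y).trans_lt (ENNReal.add_lt_top.2 ⟨hx, hy⟩)
  zero_mem' := by
    have h := p.smul' 0 0
    simp only [smul_zero, enorm_zero, zero_mul] at h
    simp [h]
  smul_mem' := fun a x hx => by
    have hx' : p x < ∞ := hx
    change p (a • x) < ∞
    rw [p.smul' a x]
    exact ENNReal.mul_lt_top enorm_lt_top hx'

/-- The space `{x : p x < ∞}` as a type of its own; it carries the norm `p x + ‖x‖`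
(and not the norm restricted from the ambient space `E`). -/
def Space (p : ExtSeminorm E) : Type _ := p.finite

instance (p : ExtSeminorm E) : AddCommGroup p.Space := inferInstanceAs (AddCommGroup p.finite)

instance (p : ExtSeminorm E) : Module ℝ p.Space := inferInstanceAs (Module ℝ p.finite)

/-- The inclusion of `{x : p x < ∞}` into the ambient space. -/
def incl (p : ExtSeminorm E) : p.Space →ₗ[ℝ] E := p.finite.subtype

instance (p : ExtSeminorm E) : Norm p.Space := ⟨fun x => (p (p.incl x)).toReal + ‖p.incl x‖⟩

theorem norm_def (p : ExtSeminorm E) (x : p.Space) :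
    ‖x‖ = (p (p.incl x)).toReal + ‖p.incl x‖ := rfl

theorem lt_top (p : ExtSeminorm E) (x : p.Space) : p (p.incl x) < ∞ := x.2

theorem normCore (p : ExtSeminorm E) : NormedSpace.Core ℝ p.Space where
  norm_nonneg x := by rw [norm_def]; positivity
  norm_smul a x := by
    rw [norm_def, norm_def, map_smul, p.smul', norm_smul, ENNReal.toReal_mul, toReal_enorm]
    ring
  norm_triangle x y := by
    have h1 : (p (p.incl (x + y))).toReal ≤ (p (p.incl x)).toReal + (p (p.incl y)).toReal := by
      rw [← ENNReal.toReal_add (p.lt_top x).ne (p.lt_top y).ne, map_add]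
      exact ENNReal.toReal_mono (ENNReal.add_ne_top.2 ⟨(p.lt_top x).ne, (p.lt_top y).ne⟩)
        (p.add_le' _ _)
    have h2 : ‖p.incl (x + y)‖ ≤ ‖p.incl x‖ + ‖p.incl y‖ := by
      rw [map_add]; exact norm_add_le _ _
    rw [norm_def, norm_def, norm_def]
    linarith
  norm_eq_zero_iff x := by
    constructor
    · intro h
      rw [norm_def] at h
      have h1 : 0 ≤ (p (p.incl x)).toReal := ENNReal.toReal_nonneg
      have h2 : ‖p.incl x‖ = 0 := le_antisymm (by linarith) (norm_nonneg _)
      exact Subtype.ext (norm_eq_zero.1 h2)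
    · rintro rfl
      have h := p.smul' 0 0
      simp only [smul_zero, enorm_zero, zero_mul] at h
      rw [norm_def, map_zero, h]
      simp

instance (p : ExtSeminorm E) : NormedAddCommGroup p.Space :=
  NormedAddCommGroup.ofCore p.normCore

instance (p : ExtSeminorm E) : NormedSpace ℝ p.Space :=
  NormedSpace.ofCore p.normCore

end ExtSeminorm

section Dynamics

variable {M : Type*} [MeasurableSpace M]

/-- The Perron-Frobenius operator of `f` on `L¹(m)`: the density with respect to `m` of the
push-forward under `f` of the signed measure `φ dm`. -/
def perronFrobenius (f : M → M) (m : Measure M) (φ : M →₁[m] ℝ) : M →₁[m] ℝ :=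
  (SignedMeasure.integrable_rnDeriv ((m.withDensityᵥ φ).map f) m).toL1
    (SignedMeasure.rnDeriv ((m.withDensityᵥ φ).map f) m)

/-- The functional-analytic conditions on the seminorm `p` on `L¹(m)`, the space
`B = {φ ∈ L¹(m) : p φ < ∞}` with norm `p φ + ‖φ‖₁`, and the Perron-Frobenius operator of `f`. -/
structure IsAdapted (f : M → M) (m : Measure M) (p : ExtSeminorm (M →₁[m] ℝ)) : Prop where
  /-- `B` is a Banach space -/
  complete : CompleteSpace p.Space
  /-- the inclusion of `B` in `L¹(m)` is compact -/
  compact : IsCompactOperator p.incl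
  /-- the operator maps `B` to `B` and is bounded there -/
  bounded : ∃ K : ℝ, ∀ φ : p.Space, ∃ χ : p.Space,
    p.incl χ = perronFrobenius f m (p.incl φ) ∧ ‖χ‖ ≤ K * ‖φ‖
  /-- the Lasota-Yorke inequality -/
  lasotaYorke : ∃ n₀ : ℕ, 1 ≤ n₀ ∧ ∃ α β : ℝ, 0 < α ∧ α < 1 ∧ 0 < β ∧ ∀ φ : p.Space,
    p ((perronFrobenius f m)^[n₀] (p.incl φ)) ≤
      ENNReal.ofReal α * p (p.incl φ) + ENNReal.ofReal β * ‖p.incl φ‖ₑ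
  /-- `B` is closed under multiplication, which is bounded for the norm of `B` -/
  algebra : ∃ C : ℝ, 0 < C ∧ ∀ φ ψ : p.Space, ∃ χ : p.Space,
    (p.incl χ =ᵐ[m] fun x => p.incl φ x * p.incl ψ x) ∧ ‖χ‖ ≤ C * ‖φ‖ * ‖ψ‖
  /-- `B` is continuously included in `L^∞(m)` -/
  bounded_embedding : ∃ C : ℝ, 0 < C ∧ ∀ φ : p.Space,
    eLpNorm (p.incl φ) ∞ m ≤ ENNReal.ofReal (C * ‖φ‖)

/-- `μ` is an `f`-invariant probability measure, absolutely continuous with respect to `m`. -/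
structure IsACIP (f : M → M) (m μ : Measure M) : Prop where
  prob : IsProbabilityMeasure μ
  invariant : MeasurePreserving f μ μ
  ac : μ ≪ m

/-- `f` is (strongly) mixing for `μ`. -/
def IsMixing (f : M → M) (μ : Measure M) : Prop :=
  ∀ s t : Set M, MeasurableSet s → MeasurableSet t →
    Tendsto (fun n : ℕ => μ (s ∩ f^[n] ⁻¹' t)) atTop (𝓝 (μ s * μ t))

/-- `|∫ φ ψ dμ - ∫ φ dμ ∫ ψ dμ|`. -/
def absCov (μ : Measure M) (φ ψ : M → ℝ) : ℝ :=
  |(∫ x, φ x * ψ x ∂μ) - (∫ x, φ x ∂μ) * ∫ x, ψ x ∂μ|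

/-- The correlation `Cor_μ(φ, ψ)` of `φ ∈ B` and `ψ ∈ L¹(μ)`. -/
def correlation {m : Measure M} (p : ExtSeminorm (M →₁[m] ℝ)) (μ : Measure M)
    (φ : p.Space) (ψ : M → ℝ) : ℝ :=
  (1 / (‖φ‖ * ∫ x, |ψ x| ∂μ)) * absCov μ (p.incl φ) ψ

/-- The large deviation `LD_μ(φ, ε, n)` of the time averages of `φ`. -/
def largeDeviation (f : M → M) (μ : Measure M) (φ : M → ℝ) (ε : ℝ) (n : ℕ) : ℝ :=
  μ.real {x | ε < |(1 / (n : ℝ)) * ∑ i ∈ Finset.range n, φ (f^[i] x) - ∫ y, φ y ∂μ|}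

end Dynamics

end

/-! The Lasota-Yorke inequality says that high powers of the transfer operator are small in the
strong norm up to a multiple of the `L¹` norm. Since the unit ball of `B` is precompact in `L¹`,
control in `L¹` can be upgraded to control in `B`; no spectral theory is used.

Existence (`exists_fixedPoint`, `exists_acip`): Cesàro averages of an orbit have an `L¹`-convergent
subsequence, the inequality makes it converge in `B`, and its limit is fixed. Started at a nonzero
square, this gives an invariant density in `B`.

Decay (`density_mem`, `tendsto_of_mixing`, `exponential_decay`): a mixing `μ` that dominates every
acip is the one constructed, so `h = dμ/dm` lies in `B`, and so does `g = (φ - ∫ φ dμ) h`. Mixing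
sends the integrals of `Pⁿ g` over sets to zero, precompactness turns this into `L¹` convergence,
uniform on the unit ball, and the inequality then makes a fixed power of `P` halve the norms of all
such `g`. Duality and the embedding in `L^∞` translate this into correlations.

Large deviations: `φ - ∫ φ dμ` is a reverse martingale difference plus a bounded coboundary plus a
small error, so the Azuma-Hoeffding method applies. -/

/-! ### Abstract Lasota-Yorke operators: power bounds, decay, fixed points. -/

section LasotaYorke

variable {B X : Type*} [NormedAddCommGroup B] [NormedSpace ℝ B] [NormedAddCommGroup X]
  [NormedSpace ℝ X]

/-- A bounded operator `T` on `B` that is a contraction for the weak norm `‖ι x‖` and satisfies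
a Lasota-Yorke inequality. -/
structure IsLasotaYorke (T : B →L[ℝ] B) (ι : B →L[ℝ] X) : Prop where
  weak_le : ∀ x, ‖ι x‖ ≤ ‖x‖
  contraction : ∀ x, ‖ι (T x)‖ ≤ ‖ι x‖
  ineq : ∃ n₀ : ℕ, 1 ≤ n₀ ∧ ∃ α b : ℝ, 0 < α ∧ α < 1 ∧ 0 < b ∧
    ∀ x, ‖(T ^ n₀) x‖ ≤ α * ‖x‖ + b * ‖ι x‖

namespace IsLasotaYorke

variable {T : B →L[ℝ] B} {ι : B →L[ℝ] X}

theorem weak_pow_le (h : IsLasotaYorke T ι) (n : ℕ) (x : B) : ‖ι ((T ^ n) x)‖ ≤ ‖ι x‖ := by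
  induction n with
  | zero => simp
  | succ n ih =>
    rw [pow_succ']
    exact (h.contraction _).trans ih

/-- Iterated Lasota-Yorke inequality. -/
theorem iterate (h : IsLasotaYorke T ι) : ∃ n₀ : ℕ, 1 ≤ n₀ ∧ ∃ α D : ℝ, 0 < α ∧ α < 1 ∧ 0 < D ∧
    ∀ (k : ℕ) (x : B), ‖(T ^ (n₀ * k)) x‖ ≤ α ^ k * ‖x‖ + D * ‖ι x‖ := by
  obtain ⟨n₀, hn, α, b, h0, h1, hb, H⟩ := h.ineq
  have h2 : 0 < 1 - α := by linarith
  refine ⟨n₀, hn, α, b / (1 - α), h0, h1, by positivity, fun k x => ?_⟩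
  have hD : α * (b / (1 - α)) + b = b / (1 - α) := by
    field_simp
    ring
  induction k with
  | zero =>
    have : 0 ≤ b / (1 - α) * ‖ι x‖ := by positivity
    simpa using this
  | succ k ih =>
    rw [Nat.mul_succ, add_comm, pow_add]
    calc ‖(T ^ n₀) ((T ^ (n₀ * k)) x)‖
        ≤ α * ‖(T ^ (n₀ * k)) x‖ + b * ‖ι ((T ^ (n₀ * k)) x)‖ := H _
      _ ≤ α * (α ^ k * ‖x‖ + b / (1 - α) * ‖ι x‖) + b * ‖ι x‖ := by
          gcongr
          exact h.weak_pow_le _ _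
      _ = α ^ (k + 1) * ‖x‖ + (α * (b / (1 - α)) + b) * ‖ι x‖ := by ring
      _ = _ := by rw [hD]

/-- The point is the order of quantifiers: `D` is chosen before `ε`, so the weak norm can be made
small relative to `D` independently of `k`. -/
theorem exists_small (h : IsLasotaYorke T ι) : ∃ D : ℝ, 0 < D ∧ ∀ ε : ℝ, 0 < ε → ∃ k : ℕ,
    ∀ x : B, ‖(T ^ k) x‖ ≤ ε * ‖x‖ + D * ‖ι x‖ := by
  obtain ⟨n₀, -, α, D, h0, h1, hD, H⟩ := h.iterate
  refine ⟨D, hD, fun ε hε => ?_⟩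
  obtain ⟨k, hk⟩ := exists_pow_lt_of_lt_one hε h1
  exact ⟨n₀ * k, fun x => (H k x).trans (by gcongr)⟩

theorem power_bounded (h : IsLasotaYorke T ι) :
    ∃ C : ℝ, 1 ≤ C ∧ ∀ (n : ℕ) (x : B), ‖(T ^ n) x‖ ≤ C * ‖x‖ := by
  obtain ⟨n₀, hn, α, D, h0, h1, hD, H⟩ := h.iterate
  obtain ⟨K, hK⟩ := ((Finset.range n₀).image fun i => ‖T ^ i‖).exists_le
  refine ⟨max 1 K * (1 + D), ?_, fun n x => ?_⟩
  · nlinarith [le_max_left 1 K]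
  · have hr : n % n₀ < n₀ := Nat.mod_lt _ hn
    rw [← Nat.mod_add_div n n₀, pow_add]
    calc ‖(T ^ (n % n₀)) ((T ^ (n₀ * (n / n₀))) x)‖
        ≤ ‖T ^ (n % n₀)‖ * ‖(T ^ (n₀ * (n / n₀))) x‖ := ContinuousLinearMap.le_opNorm _ _
      _ ≤ max 1 K * (1 * ‖x‖ + D * ‖x‖) := by
          gcongr
          · exact (hK _ (Finset.mem_image_of_mem _ (Finset.mem_range.2 hr))).trans (le_max_right _ _)
          · refine (H _ x).trans ?_
            gcongr
            · exact pow_le_one₀ h0.le h1.le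
            · exact h.weak_le x
      _ = _ := by ring

/-- Exponential decay of the iterates on the subspace where they tend to zero weakly. -/
theorem exponential_decay (h : IsLasotaYorke T ι) (hc : IsCompactOperator ι) :
    ∃ C τ : ℝ, 0 < C ∧ 0 < τ ∧ ∀ x : B, Tendsto (fun n : ℕ => ι ((T ^ n) x)) atTop (𝓝 0) →
      ∀ n : ℕ, ‖(T ^ n) x‖ ≤ C * Real.exp (-τ * n) * ‖x‖ := by
  set V : Set B := {x | Tendsto (fun n : ℕ => ι ((T ^ n) x)) atTop (𝓝 0)} with hV
  have hVT : ∀ k : ℕ, ∀ x ∈ V, (T ^ k) x ∈ V := fun k x hx => by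
    have := hx.comp (tendsto_add_atTop_nat k)
    refine this.congr fun n => ?_
    rw [Function.comp_apply, pow_add]
    rfl
  have hVs : ∀ (a : ℝ), ∀ x ∈ V, a • x ∈ V := fun a x hx => by
    have : Tendsto (fun n : ℕ => a • ι ((T ^ n) x)) atTop (𝓝 (a • 0)) := hx.const_smul a
    simpa only [hV, Set.mem_ofPred_eq, map_smul, smul_zero] using this
  obtain ⟨C, hC1, hC⟩ := h.power_bounded
  have hC0 : 0 < C := by linarith
  obtain ⟨D, hD, HD⟩ := h.exists_small
  -- Pointwise convergence becomes uniform on the unit ball of `V`: follow the orbits of a finite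
  -- weak net, and use that `T` does not increase weak distances.
  have unif : ∀ ε : ℝ, 0 < ε → ∃ N : ℕ, ∀ n ≥ N, ∀ x ∈ V, ‖x‖ ≤ 1 → ‖ι ((T ^ n) x)‖ ≤ ε := by
    intro ε hε
    have tb : TotallyBounded (ι '' (V ∩ Metric.closedBall 0 1)) :=
      (hc.isCompact_closure_image_closedBall 1).totallyBounded.subset
        ((Set.image_mono Set.inter_subset_right).trans subset_closure)
    obtain ⟨t, hts, htf, ht⟩ := Metric.finite_approx_of_totallyBounded tb (ε / 2) (by positivity)
    -- The net is lifted to points of `V` itself, one for each point of `t`, so that the lift stays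
    -- finite.
    obtain ⟨s, hs, hsf, rfl⟩ : ∃ s ⊆ V ∩ Metric.closedBall 0 1, s.Finite ∧ ι '' s = t := by
      obtain ⟨s, hs, hst⟩ := Set.exists_subset_bijOn (V ∩ Metric.closedBall 0 1 ∩ ι ⁻¹' t) ι
      refine ⟨s, hs.trans Set.inter_subset_left, ?_, ?_⟩
      · refine Set.Finite.of_finite_image ?_ hst.injOn
        exact htf.subset (hst.image_eq ▸ by rintro _ ⟨y, hy, rfl⟩; exact hy.2)
      · rw [hst.image_eq]
        apply Set.Subset.antisymm
        · rintro _ ⟨y, hy, rfl⟩; exact hy.2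
        · intro y hy
          obtain ⟨z, hz, rfl⟩ := hts hy
          exact ⟨z, ⟨hz, hy⟩, rfl⟩
    have ev : ∀ᶠ n : ℕ in atTop, ∀ y ∈ s, ‖ι ((T ^ n) y)‖ < ε / 2 := by
      rw [Set.Finite.eventually_all hsf]
      intro y hy
      have := (tendsto_zero_iff_norm_tendsto_zero.1 (hs hy).1).eventually
        (gt_mem_nhds (show (0:ℝ) < ε / 2 by positivity))
      exact this
    obtain ⟨N, hN⟩ := eventually_atTop.1 ev
    refine ⟨N, fun n hn x hx hx1 => ?_⟩
    have hmem := ht ⟨x, ⟨hx, by simpa using hx1⟩, rfl⟩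
    simp only [Set.mem_iUnion, Metric.mem_ball, exists_prop, Set.exists_mem_image] at hmem
    obtain ⟨y, hy, hxy⟩ := hmem
    calc ‖ι ((T ^ n) x)‖ = ‖ι ((T ^ n) (x - y)) + ι ((T ^ n) y)‖ := by simp
      _ ≤ ‖ι ((T ^ n) (x - y))‖ + ‖ι ((T ^ n) y)‖ := norm_add_le _ _
      _ ≤ ε / 2 + ε / 2 := by
          refine add_le_add ((h.weak_pow_le n _).trans ?_) (hN n hn y hy).le
          rw [map_sub, ← dist_eq_norm]
          exact hxy.le
      _ = ε := by ring
  -- The strong and the weak term will each contribute one quarter of `‖x‖`.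
  obtain ⟨k, hk⟩ := HD (1 / (4 * C)) (by positivity)
  obtain ⟨N, hN⟩ := unif (1 / (4 * D)) (by positivity)
  -- Taking `N + 1` instead of `N` keeps the block length `R` positive.
  have half : ∀ x ∈ V, ‖(T ^ (k + (N + 1))) x‖ ≤ 1 / 2 * ‖x‖ := by
    intro x hx
    rcases eq_or_ne x 0 with rfl | hx0
    · simp
    have hx0' : 0 < ‖x‖ := norm_pos_iff.2 hx0
    have hw : ‖ι ((T ^ (N + 1)) x)‖ ≤ 1 / (4 * D) * ‖x‖ := by
      have := hN (N + 1) (by omega) (‖x‖⁻¹ • x) (hVs _ x hx) (by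
        rw [norm_smul, norm_inv, norm_norm, inv_mul_cancel₀ hx0'.ne'])
      rw [map_smul, map_smul, norm_smul, norm_inv, norm_norm, inv_mul_le_iff₀ hx0'] at this
      linarith
    rw [pow_add]
    calc ‖(T ^ k) ((T ^ (N + 1)) x)‖
        ≤ 1 / (4 * C) * ‖(T ^ (N + 1)) x‖ + D * ‖ι ((T ^ (N + 1)) x)‖ := hk _
      _ ≤ 1 / (4 * C) * (C * ‖x‖) + D * (1 / (4 * D) * ‖x‖) := by
          gcongr
          exact hC _ _
      _ = 1 / 2 * ‖x‖ := by field_simp; ring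
  set R := k + (N + 1) with hR
  have hR0 : 0 < R := by omega
  have geo : ∀ (j : ℕ), ∀ x ∈ V, ‖(T ^ (R * j)) x‖ ≤ (1 / 2) ^ j * ‖x‖ := by
    intro j x hx
    induction j with
    | zero => simp
    | succ j ih =>
      rw [Nat.mul_succ, add_comm, pow_add]
      calc ‖(T ^ R) ((T ^ (R * j)) x)‖ ≤ 1 / 2 * ‖(T ^ (R * j)) x‖ := half _ (hVT _ x hx)
        _ ≤ 1 / 2 * ((1 / 2) ^ j * ‖x‖) := by gcongr
        _ = _ := by ring
  -- `C` pays for the incomplete last block, and the factor `2` for rounding `n / R` down.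
  refine ⟨C * 2, Real.log 2 / R, by positivity, by positivity, fun x hx n => ?_⟩
  have hn : (n : ℝ) ≤ R * ((n / R : ℕ) + 1) := by
    have := Nat.lt_mul_div_succ n hR0
    exact_mod_cast this.le
  have hexp : (1 / 2 : ℝ) ^ (n / R) ≤ 2 * Real.exp (-(Real.log 2 / R) * n) := by
    have h1 : (1 / 2 : ℝ) ^ (n / R) = Real.exp (-Real.log 2 * (n / R : ℕ)) := by
      rw [mul_comm, Real.exp_nat_mul, Real.exp_neg, Real.exp_log two_pos, one_div]
    have h2 : 2 * Real.exp (-(Real.log 2 / R) * n)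
        = Real.exp (Real.log 2 + -(Real.log 2 / R) * n) := by
      rw [Real.exp_add, Real.exp_log two_pos]
    rw [h1, h2, Real.exp_le_exp]
    have h3 : Real.log 2 / R * n ≤ Real.log 2 / R * (R * ((n / R : ℕ) + 1)) := by
      have := Real.log_pos one_lt_two
      gcongr
    have h4 : Real.log 2 / R * (R * (((n / R : ℕ) : ℝ) + 1))
        = Real.log 2 * (((n / R : ℕ) : ℝ) + 1) := by
      have : (R : ℝ) ≠ 0 := by positivity
      field_simp
    linarith
  calc ‖(T ^ n) x‖ = ‖(T ^ (n % R)) ((T ^ (R * (n / R))) x)‖ := by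
        conv_lhs => rw [← Nat.mod_add_div n R, pow_add]
        rfl
    _ ≤ C * ‖(T ^ (R * (n / R))) x‖ := hC _ _
    _ ≤ C * ((1 / 2) ^ (n / R) * ‖x‖) := by gcongr; exact geo _ x hx
    _ ≤ C * (2 * Real.exp (-(Real.log 2 / R) * n) * ‖x‖) := by gcongr
    _ = _ := by ring

/-- The Cesàro averages of an orbit accumulate, in the strong norm, at a fixed point. -/
theorem exists_fixedPoint [CompleteSpace B] (h : IsLasotaYorke T ι) (hc : IsCompactOperator ι)
    (x : B) : ∃ (y : B) (u : ℕ → ℕ), StrictMono u ∧ T y = y ∧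
      Tendsto (fun j => ((u j : ℝ) + 1)⁻¹ • ∑ i ∈ Finset.range (u j + 1), (T ^ i) x) atTop
        (𝓝 y) := by
  obtain ⟨C, hC1, hC⟩ := h.power_bounded
  have hC0 : 0 < C := by linarith
  obtain ⟨D, hD, HD⟩ := h.exists_small
  set A : ℕ → B := fun n => ((n : ℝ) + 1)⁻¹ • ∑ i ∈ Finset.range (n + 1), (T ^ i) x with hA
  have hAb : ∀ n, ‖A n‖ ≤ C * ‖x‖ := fun n => by
    have hn : (0 : ℝ) < n + 1 := by positivity
    rw [hA]
    simp only
    rw [norm_smul, norm_inv, Real.norm_of_nonneg hn.le, inv_mul_le_iff₀ hn]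
    refine (norm_sum_le_of_le _ fun i _ => hC i x).trans ?_
    simp
  -- The difference telescopes to two terms of a bounded orbit, divided by `n + 1`.
  have hA1 : Tendsto (fun n => A n - T (A n)) atTop (𝓝 0) := by
    have e : ∀ n, A n - T (A n) = ((n : ℝ) + 1)⁻¹ • (x - (T ^ (n + 1)) x) := fun n => by
      have := Finset.sum_range_sub' (fun i => (T ^ i) x) (n + 1)
      simp only [hA, map_smul, map_sum, ← smul_sub, ← Finset.sum_sub_distrib]
      congr 1
      simpa [pow_succ'] using this
    refine squeeze_zero_norm (a := fun n : ℕ => (1 + C) * ‖x‖ * (1 / ((n : ℝ) + 1))) (fun n => ?_)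
      (by simpa using tendsto_one_div_add_atTop_nhds_zero_nat.const_mul ((1 + C) * ‖x‖))
    have hn : (0 : ℝ) < n + 1 := by positivity
    rw [e, norm_smul, norm_inv, Real.norm_of_nonneg hn.le, mul_comm, one_div]
    gcongr
    refine (norm_sub_le _ _).trans ?_
    linarith [hC (n + 1) x]
  have hAk : ∀ k : ℕ, Tendsto (fun n => A n - (T ^ k) (A n)) atTop (𝓝 0) := fun k => by
    induction k with
    | zero => simp
    | succ k ih =>
      have h2 : Tendsto (fun n => T (A n - (T ^ k) (A n))) atTop (𝓝 (T 0)) :=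
        (T.continuous.tendsto 0).comp ih
      have := hA1.add h2
      simp only [map_zero, add_zero] at this
      refine this.congr fun n => ?_
      simp [pow_succ']
  obtain ⟨z, -, u, hu, hz⟩ := (hc.isCompact_closure_image_closedBall (C * ‖x‖)).tendsto_subseq
    (x := fun n => ι (A n)) fun n => subset_closure ⟨A n, by simpa using hAb n, rfl⟩
  have cw : CauchySeq fun j => ι (A (u j)) := hz.cauchySeq
  -- Up to terms tending to zero, `A (u i) - A (u j)` equals its image under `T ^ k`, whose strong
  -- norm is bounded by a small multiple of a bounded quantity plus `D` times a weak distance.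
  have cs : CauchySeq fun j => A (u j) := by
    rw [Metric.cauchySeq_iff]
    intro ε hε
    obtain ⟨k, hk⟩ := HD (ε / (4 * (2 * (C * ‖x‖) + 1))) (by positivity)
    obtain ⟨N₁, hN₁⟩ := Metric.cauchySeq_iff.1 cw (ε / (4 * D)) (by positivity)
    obtain ⟨N₂, hN₂⟩ := eventually_atTop.1 ((tendsto_zero_iff_norm_tendsto_zero.1
      ((hAk k).comp hu.tendsto_atTop)).eventually
        (gt_mem_nhds (show (0 : ℝ) < ε / 4 by positivity)))
    refine ⟨max N₁ N₂, fun i hi j hj => ?_⟩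
    have h1 := hN₁ i (le_of_max_le_left hi) j (le_of_max_le_left hj)
    have h2 := hN₂ i (le_of_max_le_right hi)
    have h3 := hN₂ j (le_of_max_le_right hj)
    simp only [Function.comp] at h2 h3
    rw [dist_eq_norm, ← map_sub] at h1
    have h4 : ‖A (u i) - A (u j)‖ ≤ 2 * (C * ‖x‖) := by
      refine (norm_sub_le _ _).trans ?_
      linarith [hAb (u i), hAb (u j)]
    have h5 : ‖(T ^ k) (A (u i) - A (u j))‖ < ε / 2 := by
      calc _ ≤ _ := hk _
        _ ≤ ε / (4 * (2 * (C * ‖x‖) + 1)) * (2 * (C * ‖x‖) + 1)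
            + D * ‖ι (A (u i) - A (u j))‖ := by gcongr; linarith
        _ < ε / (4 * (2 * (C * ‖x‖) + 1)) * (2 * (C * ‖x‖) + 1) + D * (ε / (4 * D)) := by
            gcongr
        _ = ε / 2 := by
            have : 2 * (C * ‖x‖) + 1 ≠ 0 := by positivity
            field_simp
            ring
    rw [dist_eq_norm]
    calc ‖A (u i) - A (u j)‖
        = ‖(A (u i) - (T ^ k) (A (u i))) - (A (u j) - (T ^ k) (A (u j)))
            + (T ^ k) (A (u i) - A (u j))‖ := by
          rw [map_sub]; congr 1; abel
      _ ≤ ‖A (u i) - (T ^ k) (A (u i))‖ + ‖A (u j) - (T ^ k) (A (u j))‖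
            + ‖(T ^ k) (A (u i) - A (u j))‖ :=
          (norm_add_le _ _).trans (by gcongr; exact norm_sub_le _ _)
      _ < ε := by linarith
  obtain ⟨y, hy⟩ := cauchySeq_tendsto_of_complete cs
  refine ⟨y, u, hu, ?_, hy⟩
  have h1 : Tendsto (fun j => A (u j) - T (A (u j))) atTop (𝓝 (y - T y)) :=
    hy.sub ((T.continuous.tendsto y).comp hy)
  exact (sub_eq_zero.1 (tendsto_nhds_unique h1 (hA1.comp hu.tendsto_atTop)) :).symm

end IsLasotaYorke

end LasotaYorke

/-! ### Duality and contraction for the Perron-Frobenius operator on `L¹`. -/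

section Transfer

variable {M : Type*} [MeasurableSpace M] {m : Measure M}

theorem L1.ext_setIntegral {φ ψ : M →₁[m] ℝ}
    (h : ∀ s, MeasurableSet s → ∫ x in s, φ x ∂m = ∫ x in s, ψ x ∂m) : φ = ψ :=
  Lp.ext (Integrable.ae_eq_of_forall_setIntegral_eq _ _ (L1.integrable_coeFn φ)
    (L1.integrable_coeFn ψ) fun s hs _ => h s hs)

/-- Duality between the transfer operator and composition. -/
theorem integral_mul_eq_of_setIntegral_eq {g : M → M} (hg : Measure.QuasiMeasurePreserving g m m)
    {φ χ ψ : M → ℝ} (hφ : Integrable φ m) (hχ : Integrable χ m)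
    (h : ∀ s, MeasurableSet s → ∫ x in s, χ x ∂m = ∫ x in g ⁻¹' s, φ x ∂m)
    (hψ : AEStronglyMeasurable ψ m) (h1 : Integrable (fun x => χ x * ψ x) m)
    (h2 : Integrable (fun x => φ x * ψ (g x)) m) :
    ∫ x, χ x * ψ x ∂m = ∫ x, φ x * ψ (g x) ∂m := by
  -- Nonsingularity of `g` ensures that changing `ψ` on a null set changes `ψ ∘ g` only on a null
  -- set.
  wlog hm : Measurable ψ generalizing ψ
  · have e := hψ.ae_eq_mk
    have e2 : ∀ᵐ x ∂m, ψ (g x) = hψ.mk ψ (g x) := hg.ae e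
    have e3 : (fun x => χ x * ψ x) =ᵐ[m] fun x => χ x * hψ.mk ψ x := by
      filter_upwards [e] with x hx
      rw [hx]
    have e4 : (fun x => φ x * ψ (g x)) =ᵐ[m] fun x => φ x * hψ.mk ψ (g x) := by
      filter_upwards [e2] with x hx
      rw [hx]
    rw [integral_congr_ae e3, integral_congr_ae e4]
    exact this hψ.stronglyMeasurable_mk.aestronglyMeasurable (h1.congr e3) (h2.congr e4)
      hψ.stronglyMeasurable_mk.measurable
  have simple : ∀ u : SimpleFunc M ℝ, ∫ x, χ x * u x ∂m = ∫ x, φ x * u (g x) ∂m := by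
    have ib : ∀ (u : SimpleFunc M ℝ), Integrable (fun x => χ x * u x) m ∧
        Integrable (fun x => φ x * u (g x)) m := fun u => by
      obtain ⟨c, hc⟩ := u.exists_forall_norm_le
      exact ⟨hχ.mul_bdd u.aestronglyMeasurable (ae_of_all _ hc),
        hφ.mul_bdd (u.measurable.comp hg.measurable).aestronglyMeasurable
          (ae_of_all _ fun x => hc (g x))⟩
    intro u
    induction u using SimpleFunc.induction with
    | const c hs =>
      rename_i s
      have e1 : (fun x => χ x * (SimpleFunc.piecewise s hs (SimpleFunc.const M c)
          (SimpleFunc.const M 0)) x) = s.indicator fun x => χ x * c := by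
        ext x
        by_cases hx : x ∈ s <;> simp [hx]
      have e2 : (fun x => φ x * (SimpleFunc.piecewise s hs (SimpleFunc.const M c)
          (SimpleFunc.const M 0)) (g x)) = (g ⁻¹' s).indicator fun x => φ x * c := by
        ext x
        by_cases hx : g x ∈ s <;> simp [hx]
      rw [e1, e2, integral_indicator hs, integral_indicator (hg.measurable hs),
        integral_mul_const, integral_mul_const, h s hs]
    | add _ hu hv =>
      rename_i u v _
      simp only [SimpleFunc.coe_add, Pi.add_apply, mul_add]
      rw [integral_add (ib u).1 (ib v).1, integral_add (ib u).2 (ib v).2, hu, hv]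
  -- Approximation from the base point `0` gives `‖u n x‖ ≤ 2 * ‖ψ x‖`, so integrability of the two
  -- products suffices for dominated convergence and `ψ` may be unbounded.
  set u : ℕ → SimpleFunc M ℝ := SimpleFunc.approxOn ψ hm Set.univ 0 (Set.mem_univ _)
  have hu : ∀ x, Tendsto (fun n => u n x) atTop (𝓝 (ψ x)) := fun x =>
    SimpleFunc.tendsto_approxOn hm (Set.mem_univ _) (by simp)
  have hub : ∀ x n, ‖u n x‖ ≤ 2 * ‖ψ x‖ := fun x n => by
    rw [two_mul]
    exact SimpleFunc.norm_approxOn_zero_le hm (Set.mem_univ _) x n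
  have t1 : Tendsto (fun n => ∫ x, χ x * u n x ∂m) atTop (𝓝 (∫ x, χ x * ψ x ∂m)) := by
    refine tendsto_integral_of_dominated_convergence (fun x => 2 * ‖χ x * ψ x‖)
      (fun n => hχ.aestronglyMeasurable.mul (u n).aestronglyMeasurable) (h1.norm.const_mul 2)
      (fun n => ae_of_all _ fun x => ?_) (ae_of_all _ fun x => (hu x).const_mul _)
    rw [norm_mul, norm_mul]
    nlinarith [hub x n, norm_nonneg (χ x)]
  have t2 : Tendsto (fun n => ∫ x, φ x * u n (g x) ∂m) atTop (𝓝 (∫ x, φ x * ψ (g x) ∂m)) := by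
    refine tendsto_integral_of_dominated_convergence (fun x => 2 * ‖φ x * ψ (g x)‖)
      (fun n => hφ.aestronglyMeasurable.mul
        ((u n).measurable.comp hg.measurable).aestronglyMeasurable) (h2.norm.const_mul 2)
      (fun n => ae_of_all _ fun x => ?_) (ae_of_all _ fun x => (hu (g x)).const_mul _)
    rw [norm_mul, norm_mul]
    nlinarith [hub (g x) n, norm_nonneg (φ x)]
  exact tendsto_nhds_unique t1 (t2.congr fun n => (simple (u n)).symm)

variable [IsProbabilityMeasure m] {f : M → M}

/-- The characterising property of the Perron-Frobenius operator. -/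
theorem setIntegral_perronFrobenius (hf : Measure.QuasiMeasurePreserving f m m) (φ : M →₁[m] ℝ)
    {s : Set M} (hs : MeasurableSet s) :
    ∫ x in s, perronFrobenius f m φ x ∂m = ∫ x in f ⁻¹' s, φ x ∂m := by
  have hφ : Integrable φ m := L1.integrable_coeFn φ
  -- Nonsingularity of `f` leaves the push-forward without a singular part, so its density recovers
  -- it.
  have hac : (m.withDensityᵥ φ).map f ≪ᵥ m.toENNRealVectorMeasure := by
    refine VectorMeasure.AbsolutelyContinuous.mk fun t ht h0 => ?_
    rw [Measure.toENNRealVectorMeasure_apply_measurable ht] at h0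
    rw [VectorMeasure.map_apply _ hf.measurable ht,
      withDensityᵥ_apply hφ (hf.measurable ht)]
    exact setIntegral_measure_zero _ (hf.preimage_null h0)
  have hint := SignedMeasure.integrable_rnDeriv ((m.withDensityᵥ φ).map f) m
  have h1 : perronFrobenius f m φ =ᵐ[m]
      SignedMeasure.rnDeriv ((m.withDensityᵥ φ).map f) m := Integrable.coeFn_toL1 hint
  rw [integral_congr_ae (ae_restrict_of_ae h1), ← withDensityᵥ_apply hint hs,
    SignedMeasure.withDensityᵥ_rnDeriv_eq _ _ hac, VectorMeasure.map_apply _ hf.measurable hs,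
    withDensityᵥ_apply hφ (hf.measurable hs)]

theorem setIntegral_perronFrobenius_iterate (hf : Measure.QuasiMeasurePreserving f m m)
    (φ : M →₁[m] ℝ) (n : ℕ) {s : Set M} (hs : MeasurableSet s) :
    ∫ x in s, ((perronFrobenius f m)^[n] φ) x ∂m = ∫ x in f^[n] ⁻¹' s, φ x ∂m := by
  induction n generalizing s with
  | zero => simp
  | succ n ih =>
    rw [Function.iterate_succ_apply', setIntegral_perronFrobenius hf _ hs,
      ih (hf.measurable hs), Function.iterate_succ', Set.preimage_comp]

theorem perronFrobenius_add (hf : Measure.QuasiMeasurePreserving f m m) (φ ψ : M →₁[m] ℝ) :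
    perronFrobenius f m (φ + ψ) = perronFrobenius f m φ + perronFrobenius f m ψ := by
  have key : ∀ (φ ψ : M →₁[m] ℝ) (s : Set M),
      ∫ x in s, (φ + ψ : M →₁[m] ℝ) x ∂m = ∫ x in s, φ x ∂m + ∫ x in s, ψ x ∂m :=
    fun φ ψ s => by
      rw [integral_congr_ae (ae_restrict_of_ae (Lp.coeFn_add φ ψ))]
      exact integral_add (L1.integrable_coeFn φ).integrableOn (L1.integrable_coeFn ψ).integrableOn
  refine L1.ext_setIntegral fun s hs => ?_
  rw [setIntegral_perronFrobenius hf _ hs, key, key, setIntegral_perronFrobenius hf _ hs,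
    setIntegral_perronFrobenius hf _ hs]

theorem perronFrobenius_smul (hf : Measure.QuasiMeasurePreserving f m m) (a : ℝ)
    (φ : M →₁[m] ℝ) : perronFrobenius f m (a • φ) = a • perronFrobenius f m φ := by
  have key : ∀ (φ : M →₁[m] ℝ) (s : Set M),
      ∫ x in s, (a • φ : M →₁[m] ℝ) x ∂m = a * ∫ x in s, φ x ∂m := fun φ s => by
    rw [integral_congr_ae (ae_restrict_of_ae (Lp.coeFn_smul a φ))]
    exact integral_const_mul a _
  refine L1.ext_setIntegral fun s hs => ?_
  rw [setIntegral_perronFrobenius hf _ hs, key, key, setIntegral_perronFrobenius hf _ hs]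

/-- Where the image has constant sign, its absolute integral is plus or minus the integral of `φ`
over the preimage; the two preimages partition the space. -/
theorem norm_perronFrobenius_le (hf : Measure.QuasiMeasurePreserving f m m) (φ : M →₁[m] ℝ) :
    ‖perronFrobenius f m φ‖ ≤ ‖φ‖ := by
  have hφ : Integrable φ m := L1.integrable_coeFn φ
  set χ := perronFrobenius f m φ with hχ
  have hχi : Integrable χ m := L1.integrable_coeFn χ
  set s : Set M := {x | 0 ≤ χ x}
  have hs : MeasurableSet s :=
    measurableSet_le measurable_const (Lp.stronglyMeasurable χ).measurable
  have h1 : ∫ x in s, ‖χ x‖ ∂m ≤ ∫ x in f ⁻¹' s, ‖φ x‖ ∂m := by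
    rw [setIntegral_congr_fun hs fun x (hx : 0 ≤ χ x) => Real.norm_of_nonneg hx,
      setIntegral_perronFrobenius hf φ hs]
    exact (Real.le_norm_self _).trans (norm_integral_le_integral_norm fun x => φ x)
  have h2 : ∫ x in sᶜ, ‖χ x‖ ∂m ≤ ∫ x in (f ⁻¹' s)ᶜ, ‖φ x‖ ∂m := by
    rw [setIntegral_congr_fun hs.compl fun x (hx : ¬ 0 ≤ χ x) =>
      Real.norm_of_nonpos (not_le.1 hx).le, integral_neg, setIntegral_perronFrobenius hf φ hs.compl]
    rw [Set.preimage_compl]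
    exact (neg_le_abs _).trans (norm_integral_le_integral_norm fun x => φ x)
  rw [L1.norm_eq_integral_norm, L1.norm_eq_integral_norm, ← integral_add_compl hs hχi.norm,
    ← integral_add_compl (hf.measurable hs) hφ.norm]
  exact add_le_add h1 h2

end Transfer

/-! ### The transfer operator restricted to `B`. -/

namespace ExtSeminorm

variable {E : Type*} [NormedAddCommGroup E] [NormedSpace ℝ E] (p : ExtSeminorm E)

theorem norm_incl_le (x : p.Space) : ‖p.incl x‖ ≤ ‖x‖ := by
  rw [norm_def]
  linarith [ENNReal.toReal_nonneg (a := p (p.incl x))]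

theorem incl_injective : Function.Injective p.incl := Subtype.val_injective

/-- The inclusion of `{x : p x < ∞}` as a bounded operator. -/
noncomputable def inclL : p.Space →L[ℝ] E :=
  p.incl.mkContinuous 1 fun x => by simpa using p.norm_incl_le x

@[simp]
theorem inclL_apply (x : p.Space) : p.inclL x = p.incl x := rfl

end ExtSeminorm

namespace IsAdapted

variable {M : Type*} [MeasurableSpace M] {m : Measure M} [IsProbabilityMeasure m] {f : M → M}
  {p : ExtSeminorm (M →₁[m] ℝ)}

/-- The Perron-Frobenius operator restricts to a bounded operator on `B` satisfying a Lasota-Yorke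
inequality. -/
theorem exists_operator (hp : IsAdapted f m p) (hf : Measure.QuasiMeasurePreserving f m m) :
    ∃ T : p.Space →L[ℝ] p.Space, IsLasotaYorke T p.inclL ∧
      ∀ (n : ℕ) (φ : p.Space), p.incl ((T ^ n) φ) = (perronFrobenius f m)^[n] (p.incl φ) := by
  obtain ⟨K, hK⟩ := hp.bounded
  choose T hT hTK using hK
  set L : p.Space →ₗ[ℝ] p.Space :=
    { toFun := T
      map_add' := fun φ ψ => p.incl_injective (by
        rw [map_add, hT, hT, hT, map_add, perronFrobenius_add hf])
      map_smul' := fun a φ => p.incl_injective (by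
        rw [RingHom.id_apply, map_smul, hT, hT, map_smul, perronFrobenius_smul hf]) }
  set U : p.Space →L[ℝ] p.Space := L.mkContinuous K hTK
  have hU : ∀ φ, p.incl (U φ) = perronFrobenius f m (p.incl φ) := hT
  have hUn : ∀ (n : ℕ) (φ : p.Space),
      p.incl ((U ^ n) φ) = (perronFrobenius f m)^[n] (p.incl φ) := fun n φ => by
    induction n with
    | zero => rfl
    | succ n ih =>
      rw [pow_succ', Function.iterate_succ_apply', ← ih, ← hU]
      rfl
  have hcon : ∀ φ, ‖p.inclL (U φ)‖ ≤ ‖p.inclL φ‖ := fun φ => by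
    rw [p.inclL_apply, hU]
    exact norm_perronFrobenius_le hf _
  refine ⟨U, ⟨p.norm_incl_le, hcon, ?_⟩, hUn⟩
  obtain ⟨n₀, hn, α, β, h0, h1, hβ, H⟩ := hp.lasotaYorke
  -- The hypothesis bounds the seminorm only; the `L¹` part of the full norm does not increase and
  -- adds `1` to `β`.
  refine ⟨n₀, hn, α, β + 1, h0, h1, by linarith, fun φ => ?_⟩
  have hw : ∀ n : ℕ, ‖p.inclL ((U ^ n) φ)‖ ≤ ‖p.inclL φ‖ := fun n => by
    induction n with
    | zero => rfl
    | succ n ih =>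
      rw [pow_succ']
      exact (hcon _).trans ih
  have h2 := H φ
  rw [← hUn] at h2
  have h3 := ENNReal.toReal_mono (ENNReal.add_ne_top.2
    ⟨ENNReal.mul_ne_top ENNReal.ofReal_ne_top (p.lt_top φ).ne,
      ENNReal.mul_ne_top ENNReal.ofReal_ne_top enorm_ne_top⟩) h2
  rw [ENNReal.toReal_add (ENNReal.mul_ne_top ENNReal.ofReal_ne_top (p.lt_top φ).ne)
    (ENNReal.mul_ne_top ENNReal.ofReal_ne_top enorm_ne_top), ENNReal.toReal_mul,
    ENNReal.toReal_mul, ENNReal.toReal_ofReal h0.le, ENNReal.toReal_ofReal hβ.le,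
    toReal_enorm] at h3
  have h4 := hw n₀
  rw [p.norm_def, p.norm_def φ]
  simp only [p.inclL_apply] at h4 ⊢
  nlinarith [norm_nonneg (p.incl φ)]

end IsAdapted

/-! ### Set integrals and mixing. -/

section Integrals

variable {M : Type*} [MeasurableSpace M] {m : Measure M}

/-- Integration over a set as a continuous linear functional on `L¹`. -/
noncomputable def setIntegralL (m : Measure M) (s : Set M) : (M →₁[m] ℝ) →L[ℝ] ℝ where
  toFun φ := ∫ x in s, φ x ∂m
  map_add' φ ψ := by
    rw [integral_congr_ae (ae_restrict_of_ae (Lp.coeFn_add φ ψ))]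
    exact integral_add (L1.integrable_coeFn φ).integrableOn (L1.integrable_coeFn ψ).integrableOn
  map_smul' a φ := by
    rw [integral_congr_ae (ae_restrict_of_ae (Lp.coeFn_smul a φ))]
    exact integral_const_mul a _
  cont := continuous_setIntegral s

theorem setIntegralL_apply (s : Set M) (φ : M →₁[m] ℝ) :
    setIntegralL m s φ = ∫ x in s, φ x ∂m := rfl

theorem norm_setIntegralL_le (s : Set M) (φ : M →₁[m] ℝ) : ‖setIntegralL m s φ‖ ≤ ‖φ‖ := by
  rw [setIntegralL_apply, L1.norm_eq_integral_norm]
  exact (norm_integral_le_integral_norm _).trans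
    (setIntegral_le_integral (L1.integrable_coeFn φ).norm (ae_of_all _ fun _ => norm_nonneg _))

/-- Mixing for an integrable function against a measurable set. -/
theorem IsMixing.tendsto_setIntegral {μ : Measure M} [IsProbabilityMeasure μ] {f : M → M}
    (h : IsMixing f μ) (hf : Measurable f) {t : Set M} (ht : MeasurableSet t) {φ : M → ℝ}
    (hφ : Integrable φ μ) :
    Tendsto (fun n : ℕ => ∫ x in f^[n] ⁻¹' t, φ x ∂μ) atTop (𝓝 ((∫ x, φ x ∂μ) * μ.real t)) := by
  have hft : ∀ n : ℕ, MeasurableSet (f^[n] ⁻¹' t) := fun n => hf.iterate n ht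
  refine Integrable.induction
    (P := fun φ => Tendsto (fun n : ℕ => ∫ x in f^[n] ⁻¹' t, φ x ∂μ) atTop
      (𝓝 ((∫ x, φ x ∂μ) * μ.real t))) ?_ ?_ ?_ ?_ hφ
  · intro c s hs _
    have h1 := (ENNReal.continuousAt_toReal
      (ENNReal.mul_ne_top (measure_ne_top μ s) (measure_ne_top μ t))).tendsto.comp (h s t hs ht)
    have h2 := h1.mul_const c
    have e : (∫ x, s.indicator (fun _ => c) x ∂μ) * μ.real t = (μ s * μ t).toReal * c := by
      rw [integral_indicator_const c hs, smul_eq_mul, ENNReal.toReal_mul]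
      simp only [Measure.real]
      ring
    rw [e]
    refine h2.congr fun n => ?_
    rw [setIntegral_indicator hs, setIntegral_const, smul_eq_mul, Set.inter_comm]
    rfl
  · intro φ ψ _ hφ hψ h1 h2
    have e : (∫ x, (φ + ψ) x ∂μ) * μ.real t
        = (∫ x, φ x ∂μ) * μ.real t + (∫ x, ψ x ∂μ) * μ.real t := by
      rw [integral_add' hφ hψ, add_mul]
    rw [e]
    refine (h1.add h2).congr fun n => ?_
    exact (integral_add hφ.integrableOn hψ.integrableOn).symm
  -- Closedness in `L¹`: the deviations from the limit are linear functionals of norm at most `2`,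
  -- uniformly in `n`.
  · set G : ℕ → (M →₁[μ] ℝ) →L[ℝ] ℝ := fun n =>
      setIntegralL μ (f^[n] ⁻¹' t) - μ.real t • setIntegralL μ Set.univ with hG
    have hGb : ∀ n φ, ‖G n φ‖ ≤ 2 * ‖φ‖ := fun n φ => by
      have h1 : μ.real t ≤ 1 := measureReal_le_one
      have h2 : ‖μ.real t • setIntegralL μ Set.univ φ‖ ≤ 1 * ‖φ‖ := by
        rw [norm_smul, Real.norm_of_nonneg measureReal_nonneg]
        gcongr
        exact norm_setIntegralL_le _ _
      have h3 := norm_sub_le (setIntegralL μ (f^[n] ⁻¹' t) φ) (μ.real t • setIntegralL μ Set.univ φ)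
      have h4 := norm_setIntegralL_le (f^[n] ⁻¹' t) φ
      change ‖setIntegralL μ (f^[n] ⁻¹' t) φ - μ.real t • setIntegralL μ Set.univ φ‖ ≤ _
      linarith
    have hset : ∀ φ : M →₁[μ] ℝ, Tendsto (fun n : ℕ => ∫ x in f^[n] ⁻¹' t, φ x ∂μ) atTop
        (𝓝 ((∫ x, φ x ∂μ) * μ.real t)) ↔ Tendsto (fun n => G n φ) atTop (𝓝 0) := fun φ => by
      rw [← tendsto_sub_nhds_zero_iff]
      refine iff_of_eq (congrArg (fun u => Tendsto u atTop (𝓝 0)) (funext fun n => ?_))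
      simp only [hG, sub_apply, smul_apply, setIntegralL_apply, smul_eq_mul, setIntegral_univ]
      rw [mul_comm]
    simp only [hset]
    refine isClosed_of_closure_subset fun φ hφ => ?_
    rw [Metric.mem_closure_iff] at hφ
    refine Metric.tendsto_atTop.2 fun ε hε => ?_
    obtain ⟨ψ, hψ, hd⟩ := hφ (ε / 4) (by positivity)
    obtain ⟨N, hN⟩ := Metric.tendsto_atTop.1 (show Tendsto (fun n => G n ψ) atTop (𝓝 0) from hψ)
      (ε / 2) (by positivity)
    refine ⟨N, fun n hn => ?_⟩
    have h1 := hN n hn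
    rw [dist_zero_right] at h1 ⊢
    rw [dist_eq_norm] at hd
    calc ‖G n φ‖ = ‖G n (φ - ψ) + G n ψ‖ := by rw [map_sub]; simp
      _ ≤ 2 * ‖φ - ψ‖ + ‖G n ψ‖ := (norm_add_le _ _).trans (by gcongr; exact hGb _ _)
      _ < ε := by linarith
  · intro φ ψ he _ h1
    rw [← integral_congr_ae he]
    exact h1.congr fun n => integral_congr_ae (ae_restrict_of_ae he)

/-- Mixing of an invariant set against itself gives `μ s = μ s * μ s`. -/
theorem IsMixing.ergodic {μ : Measure M} [IsProbabilityMeasure μ] {f : M → M}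
    (h : IsMixing f μ) (hf : MeasurePreserving f μ μ) : Ergodic f μ := by
  refine ⟨hf, ⟨fun {s} hs hfs => ?_⟩⟩
  have e : ∀ n : ℕ, f^[n] ⁻¹' s = s := fun n => by
    induction n with
    | zero => rfl
    | succ n ih => rw [Function.iterate_succ, Set.preimage_comp, ih, hfs]
  have h1 := h s s hs hs
  simp only [e, Set.inter_self] at h1
  have h2 : μ s = μ s * μ s := tendsto_nhds_unique tendsto_const_nhds h1
  rw [eventuallyConst_set']
  by_cases h0 : μ s = 0
  · left
    exact ae_eq_empty.2 h0
  · right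
    have h3 : μ s = 1 := by
      have := ENNReal.mul_right_inj h0 (measure_ne_top μ s) (b := 1) (c := μ s)
      rw [mul_one] at this
      exact (this.1 h2).symm
    exact ae_eq_univ.2 ((prob_compl_eq_zero_iff hs).2 h3)

theorem IsACIP.le_density {f : M → M} {μ : Measure M} {c : ℝ} (hμ : IsACIP f m μ)
    (h : ∀ᵐ x ∂m, ENNReal.ofReal c ≤ μ.rnDeriv m x) : ∀ᵐ x ∂m, c ≤ (μ.rnDeriv m x).toReal := by
  have := hμ.prob
  filter_upwards [h, Measure.rnDeriv_lt_top μ m] with x hx hx2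
  exact (ENNReal.ofReal_le_iff_le_toReal hx2.ne).1 hx

end Integrals

/-! ### Invariant measures and their densities. -/

section Density

variable {M : Type*} [MeasurableSpace M] {m : Measure M} [IsProbabilityMeasure m] {f : M → M}

theorem integral_density_mul {μ : Measure M} [IsProbabilityMeasure μ] (hμ : μ ≪ m) (u : M → ℝ) :
    ∫ x, (μ.rnDeriv m x).toReal * u x ∂m = ∫ x, u x ∂μ :=
  integral_rnDeriv_smul hμ

theorem integrable_density_mul_iff {μ : Measure M} [IsProbabilityMeasure μ] (hμ : μ ≪ m)
    {u : M → ℝ} : Integrable (fun x => (μ.rnDeriv m x).toReal * u x) m ↔ Integrable u μ :=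
  integrable_rnDeriv_smul_iff hμ

/-- A normalised nonnegative fixed point of the Perron-Frobenius operator is the density of an
absolutely continuous invariant probability measure. -/
theorem isACIP_withDensity (hf : Measure.QuasiMeasurePreserving f m m) {h : M →₁[m] ℝ}
    (hh : perronFrobenius f m h = h) (h0 : 0 ≤ᵐ[m] h) (h1 : ∫ x, h x ∂m = 1) :
    IsACIP f m (m.withDensity fun x => ENNReal.ofReal (h x)) := by
  have hi := L1.integrable_coeFn h
  have key : ∀ s, MeasurableSet s → (m.withDensity fun x => ENNReal.ofReal (h x)) s
      = ENNReal.ofReal (∫ x in s, h x ∂m) := fun s hs => by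
    rw [withDensity_apply _ hs,
      ofReal_integral_eq_lintegral_ofReal hi.integrableOn (ae_restrict_of_ae h0)]
  refine ⟨⟨?_⟩, ⟨hf.measurable, ?_⟩, withDensity_absolutelyContinuous _ _⟩
  · rw [key _ MeasurableSet.univ, setIntegral_univ, h1, ENNReal.ofReal_one]
  · ext s hs
    rw [Measure.map_apply hf.measurable hs, key _ hs, key _ (hf.measurable hs),
      ← setIntegral_perronFrobenius hf h hs, hh]

/-- A density that is positive almost everywhere gives `μ` the null sets of `m`. Hence every acip is
dominated by `μ`, and bounds `μ`-a.e. hold `m`-a.e. -/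
theorem IsACIP.absolutelyContinuous_of_le_rnDeriv {μ : Measure M} {c : ℝ}
    (hμ : IsACIP f m μ) (hc : 0 < c)
    (h : ∀ᵐ x ∂m, ENNReal.ofReal c ≤ μ.rnDeriv m x) : m ≪ μ := by
  have := hμ.prob
  have h1 := withDensity_absolutelyContinuous' (μ := m)
    (Measure.measurable_rnDeriv μ m).aemeasurable
    (h.mono fun x hx => ((ENNReal.ofReal_pos.2 hc).trans_le hx).ne')
  rwa [Measure.withDensity_rnDeriv_eq μ m hμ.ac] at h1

end Density

/-! ### An invariant density in `B`. -/

namespace IsAdapted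

variable {M : Type*} [MeasurableSpace M] {m : Measure M} {f : M → M}
  {p : ExtSeminorm (M →₁[m] ℝ)}

theorem ae_bound (hp : IsAdapted f m p) : ∃ C : ℝ, 0 < C ∧ ∀ φ : p.Space,
    ∀ᵐ x ∂m, |p.incl φ x| ≤ C * ‖φ‖ := by
  obtain ⟨C, hC, H⟩ := hp.bounded_embedding
  refine ⟨C, hC, fun φ => ?_⟩
  have h := H φ
  rw [eLpNorm_exponent_top] at h
  filter_upwards [enorm_ae_le_eLpNormEssSup (p.incl φ) m] with x hx
  have h2 := hx.trans h
  rw [← ofReal_norm, ENNReal.ofReal_le_ofReal_iff (by positivity)] at h2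
  exact h2

/-- `B` is not assumed to contain the constants; the square of a nonzero element serves as the
initial density instead. -/
theorem exists_pos (hp : IsAdapted f m p) [Nontrivial p.Space] :
    ∃ χ : p.Space, 0 ≤ᵐ[m] p.incl χ ∧ 0 < ∫ x, p.incl χ x ∂m := by
  obtain ⟨φ, hφ⟩ := exists_ne (0 : p.Space)
  obtain ⟨C, -, H⟩ := hp.algebra
  obtain ⟨χ, hχ, -⟩ := H φ φ
  have h0 : 0 ≤ᵐ[m] p.incl χ := by
    filter_upwards [hχ] with x hx
    rw [hx]
    exact mul_self_nonneg _
  refine ⟨χ, h0, (integral_nonneg_of_ae h0).lt_of_ne fun h => hφ ?_⟩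
  have h1 := (integral_eq_zero_iff_of_nonneg_ae h0 (L1.integrable_coeFn _)).1 h.symm
  refine p.incl_injective (Lp.ext ?_)
  rw [map_zero]
  filter_upwards [h1, hχ, Lp.coeFn_zero ℝ 1 m] with x hx1 hx2 hx3
  rw [hx3]
  rw [hx1] at hx2
  exact mul_self_eq_zero.1 hx2.symm

theorem integrable_incl {μ : Measure M} (hp : IsAdapted f m p) (hμ : IsACIP f m μ) (φ : p.Space) :
    Integrable (p.incl φ) μ := by
  have := hμ.prob
  obtain ⟨C, -, H⟩ := hp.ae_bound
  exact Integrable.of_bound ((Lp.stronglyMeasurable _).aestronglyMeasurable) _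
    (hμ.ac.ae_le (H φ))

/-- The function `(φ - ∫ φ dμ) dμ/dm` belongs to `B`. -/
theorem exists_centered {μ : Measure M} (hp : IsAdapted f m p) (hμ : IsACIP f m μ) {h : p.Space}
    (hh : p.incl h =ᵐ[m] fun x => (μ.rnDeriv m x).toReal) :
    ∃ C : ℝ, 0 < C ∧ ∀ φ : p.Space, ∃ g : p.Space,
      (p.incl g =ᵐ[m] fun x => (μ.rnDeriv m x).toReal * (p.incl φ x - ∫ y, p.incl φ y ∂μ)) ∧
        ‖g‖ ≤ C * ‖φ‖ := by
  have := hμ.prob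
  obtain ⟨C₁, hC₁, H₁⟩ := hp.algebra
  obtain ⟨C₂, hC₂, H₂⟩ := hp.ae_bound
  refine ⟨(C₁ + C₂) * (‖h‖ + 1), by positivity, fun φ => ?_⟩
  obtain ⟨χ, hχ, hχn⟩ := H₁ φ h
  have hI : |∫ y, p.incl φ y ∂μ| ≤ C₂ * ‖φ‖ := by
    have := norm_integral_le_of_norm_le_const (μ := μ) (f := p.incl φ) (hμ.ac.ae_le (H₂ φ))
    simpa using this
  refine ⟨χ - (∫ y, p.incl φ y ∂μ) • h, ?_, ?_⟩
  · rw [map_sub, map_smul]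
    filter_upwards [Lp.coeFn_sub (p.incl χ) ((∫ y, p.incl φ y ∂μ) • p.incl h),
      Lp.coeFn_smul (∫ y, p.incl φ y ∂μ) (p.incl h), hχ, hh] with x h1 h2 h3 h4
    rw [h1, Pi.sub_apply, h2, Pi.smul_apply, h3, h4, smul_eq_mul]
    ring
  · refine (norm_sub_le _ _).trans ?_
    rw [norm_smul, Real.norm_eq_abs]
    have h1 : |∫ y, p.incl φ y ∂μ| * ‖h‖ ≤ C₂ * ‖φ‖ * ‖h‖ := by gcongr
    nlinarith [norm_nonneg φ, norm_nonneg h, mul_nonneg (add_pos hC₁ hC₂).le (norm_nonneg φ)]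

variable [IsProbabilityMeasure m]

/-- Integrals over sets are continuous on `B`, so the limit of the averages inherits nonnegativity
and the positive total mass, which allows it to be normalised. -/
theorem exists_acip (hp : IsAdapted f m p) (hf : Measure.QuasiMeasurePreserving f m m)
    [Nontrivial p.Space] : ∃ μ : Measure M, IsACIP f m μ ∧
      ∃ h : p.Space, p.incl h =ᵐ[m] fun x => (μ.rnDeriv m x).toReal := by
  have := hp.complete
  obtain ⟨T, hT, hTP⟩ := hp.exists_operator hf
  obtain ⟨χ, hχ0, hχ1⟩ := hp.exists_pos
  obtain ⟨y, u, -, hy, hlim⟩ := hT.exists_fixedPoint hp.compact χ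
  have avg : ∀ (s : Set M), MeasurableSet s → ∀ n : ℕ,
      setIntegralL m s (p.inclL (((n : ℝ) + 1)⁻¹ • ∑ i ∈ Finset.range (n + 1), (T ^ i) χ))
        = ((n : ℝ) + 1)⁻¹ * ∑ i ∈ Finset.range (n + 1), ∫ x in f^[i] ⁻¹' s, p.incl χ x ∂m := by
    intro s hs n
    rw [map_smul, map_smul, map_sum, map_sum, smul_eq_mul]
    congr 1
    refine Finset.sum_congr rfl fun i _ => ?_
    rw [p.inclL_apply, hTP, setIntegralL_apply, setIntegral_perronFrobenius_iterate hf _ _ hs]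
  have lim : ∀ s : Set M, Tendsto (fun j => setIntegralL m s (p.inclL
      (((u j : ℝ) + 1)⁻¹ • ∑ i ∈ Finset.range (u j + 1), (T ^ i) χ))) atTop
        (𝓝 (setIntegralL m s (p.inclL y))) := fun s =>
    (((setIntegralL m s).continuous.comp p.inclL.continuous).tendsto y).comp hlim
  have y0 : 0 ≤ᵐ[m] p.incl y := by
    refine ae_nonneg_of_forall_setIntegral_nonneg (L1.integrable_coeFn _) fun s hs _ => ?_
    refine ge_of_tendsto' (lim s) fun j => ?_
    rw [avg s hs]
    exact mul_nonneg (by positivity)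
      (Finset.sum_nonneg fun i _ => setIntegral_nonneg_of_ae hχ0)
  have y1 : ∫ x, p.incl y x ∂m = ∫ x, p.incl χ x ∂m := by
    have h := lim Set.univ
    have e : ∀ j, setIntegralL m Set.univ (p.inclL
        (((u j : ℝ) + 1)⁻¹ • ∑ i ∈ Finset.range (u j + 1), (T ^ i) χ))
          = ∫ x, p.incl χ x ∂m := fun j => by
      have hj : ((u j : ℝ) + 1) ≠ 0 := by positivity
      rw [avg _ MeasurableSet.univ]
      simp only [Set.preimage_univ, setIntegral_univ, Finset.sum_const, Finset.card_range,
        nsmul_eq_mul, Nat.cast_add, Nat.cast_one]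
      field_simp
    simp only [e] at h
    have := tendsto_nhds_unique h tendsto_const_nhds
    rwa [setIntegralL_apply, setIntegral_univ] at this
  set a := ∫ x, p.incl χ x ∂m
  set h : p.Space := a⁻¹ • y
  have hae : p.incl h =ᵐ[m] fun x => a⁻¹ * p.incl y x := by
    rw [map_smul]
    exact Lp.coeFn_smul _ _
  have h0 : 0 ≤ᵐ[m] p.incl h := by
    filter_upwards [hae, y0] with x hx hx0
    rw [hx]
    exact mul_nonneg (inv_nonneg.2 hχ1.le) hx0
  have h1 : ∫ x, p.incl h x ∂m = 1 := by
    rw [integral_congr_ae hae, integral_const_mul, y1, inv_mul_cancel₀ hχ1.ne']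
  have hPh : perronFrobenius f m (p.incl h) = p.incl h := by
    have := hTP 1 h
    rw [pow_one, map_smul, hy] at this
    exact this.symm
  refine ⟨_, isACIP_withDensity hf hPh h0 h1, h, ?_⟩
  have hm : Measurable fun x => ENNReal.ofReal (p.incl h x) :=
    (Lp.stronglyMeasurable _).measurable.ennreal_ofReal
  filter_upwards [Measure.rnDeriv_withDensity m hm, h0] with x hx hx0
  rw [hx, ENNReal.toReal_ofReal hx0]

/-- If every acip is absolutely continuous with respect to an ergodic one, then the density of the
latter belongs to `B`. -/
theorem density_mem (hp : IsAdapted f m p) (hf : Measure.QuasiMeasurePreserving f m m)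
    [Nontrivial p.Space] {μ : Measure M} (hμ : IsACIP f m μ) (hmix : IsMixing f μ)
    (hu : ∀ ν : Measure M, IsACIP f m ν → ν ≪ μ) :
    ∃ h : p.Space, p.incl h =ᵐ[m] fun x => (μ.rnDeriv m x).toReal := by
  obtain ⟨ν, hν, h, hh⟩ := hp.exists_acip hf
  have := hμ.prob
  have := hν.prob
  -- An invariant probability measure dominated by an ergodic one coincides with it.
  have : ν = μ := (hmix.ergodic hμ.invariant).eq_of_absolutelyContinuous hν.invariant (hu ν hν)
  subst this
  exact ⟨h, hh⟩

/-! ### Exponential decay of correlations. -/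

section Decay

variable {μ : Measure M}

/-- Mixing implies strong convergence of the iterates, as orbits are precompact in `L¹`. -/
theorem tendsto_of_mixing (hp : IsAdapted f m p) (hf : Measure.QuasiMeasurePreserving f m m)
    (hμ : IsACIP f m μ) (hmix : IsMixing f μ) {T : p.Space →L[ℝ] p.Space}
    (hT : IsLasotaYorke T p.inclL)
    (hTP : ∀ (n : ℕ) (φ : p.Space), p.incl ((T ^ n) φ) = (perronFrobenius f m)^[n] (p.incl φ))
    {φ g : p.Space} (hg : p.incl g =ᵐ[m] fun x =>
      (μ.rnDeriv m x).toReal * (p.incl φ x - ∫ y, p.incl φ y ∂μ)) :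
    Tendsto (fun n : ℕ => p.inclL ((T ^ n) g)) atTop (𝓝 0) := by
  have := hμ.prob
  set k : M → ℝ := fun x => p.incl φ x - ∫ y, p.incl φ y ∂μ with hk
  have hki : Integrable k μ := (hp.integrable_incl hμ φ).sub (integrable_const _)
  have hk0 : ∫ x, k x ∂μ = 0 := by
    rw [hk, integral_sub (hp.integrable_incl hμ φ) (integrable_const _)]
    simp
  -- By duality the integral of `Pⁿ g` over `s` is that of `k` over `f^[n] ⁻¹' s` for `μ`, and `k`
  -- has mean zero.
  have weak : ∀ s, MeasurableSet s →
      Tendsto (fun n : ℕ => setIntegralL m s (p.inclL ((T ^ n) g))) atTop (𝓝 0) := fun s hs => by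
    have h1 := hmix.tendsto_setIntegral hf.measurable hs hki
    rw [hk0, zero_mul] at h1
    refine h1.congr fun n => ?_
    have hs' : MeasurableSet (f^[n] ⁻¹' s) := hf.measurable.iterate n hs
    rw [p.inclL_apply, hTP, setIntegralL_apply, setIntegral_perronFrobenius_iterate hf _ _ hs,
      integral_congr_ae (ae_restrict_of_ae hg), ← integral_indicator hs',
      ← integral_indicator hs', ← integral_density_mul hμ.ac]
    congr 1
    ext x
    by_cases hx : x ∈ f^[n] ⁻¹' s
    · simp only [Set.indicator_of_mem hx, hk]
    · simp only [Set.indicator_of_notMem hx, mul_zero]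
  obtain ⟨C, -, hC⟩ := hT.power_bounded
  -- Each subsequence has an `L¹`-convergent further subsequence, whose limit has zero integral over
  -- every measurable set.
  refine tendsto_of_subseq_tendsto fun ns hns => ?_
  obtain ⟨z, -, u, hu, hz⟩ :=
    (IsCompactOperator.isCompact_closure_image_closedBall hp.compact (C * ‖g‖)).tendsto_subseq
      (x := fun n => p.incl ((T ^ ns n) g))
      fun n => subset_closure ⟨_, by simpa using hC (ns n) g, rfl⟩
  have hz0 : z = 0 := by
    refine L1.ext_setIntegral fun s hs => ?_
    have h1 := ((setIntegralL m s).continuous.tendsto z).comp hz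
    have h2 := (weak s hs).comp (hns.comp hu.tendsto_atTop)
    have h3 : setIntegralL m s z = 0 := tendsto_nhds_unique h1 h2
    rw [← setIntegralL_apply, ← setIntegralL_apply, h3, map_zero]
  exact ⟨u, hz0 ▸ hz⟩

/-- Exponential convergence to equilibrium in `B`. -/
theorem exists_decay (hp : IsAdapted f m p) (hf : Measure.QuasiMeasurePreserving f m m)
    (hμ : IsACIP f m μ) (hmix : IsMixing f μ) {h : p.Space}
    (hh : p.incl h =ᵐ[m] fun x => (μ.rnDeriv m x).toReal) :
    ∃ T : p.Space →L[ℝ] p.Space,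
      (∀ (n : ℕ) (φ : p.Space), p.incl ((T ^ n) φ) = (perronFrobenius f m)^[n] (p.incl φ)) ∧
      ∃ C τ : ℝ, 0 < C ∧ 0 < τ ∧ ∀ φ : p.Space, ∃ g : p.Space,
        (p.incl g =ᵐ[m] fun x => (μ.rnDeriv m x).toReal * (p.incl φ x - ∫ y, p.incl φ y ∂μ)) ∧
          ∀ n : ℕ, ‖(T ^ n) g‖ ≤ C * Real.exp (-τ * n) * ‖φ‖ := by
  obtain ⟨T, hT, hTP⟩ := hp.exists_operator hf
  obtain ⟨C, τ, hC, hτ, H⟩ := hT.exponential_decay hp.compact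
  obtain ⟨D, hD, HD⟩ := hp.exists_centered hμ hh
  refine ⟨T, hTP, C * D, τ, by positivity, hτ, fun φ => ?_⟩
  obtain ⟨g, hg, hgn⟩ := HD φ
  refine ⟨g, hg, fun n => (H g (hp.tendsto_of_mixing hf hμ hmix hT hTP hg) n).trans ?_⟩
  calc C * Real.exp (-τ * n) * ‖g‖ ≤ C * Real.exp (-τ * n) * (D * ‖φ‖) := by gcongr
    _ = _ := by ring

/-- The covariance equals `∫ (Pⁿ g) ψ dm`, and the embedding in `L^∞` bounds `Pⁿ g` uniformly; so
`ψ` enters only through its `L¹(m)` norm. -/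
theorem exists_absCov_le (hp : IsAdapted f m p) (hf : Measure.QuasiMeasurePreserving f m m)
    (hμ : IsACIP f m μ) (hmix : IsMixing f μ) {h : p.Space}
    (hh : p.incl h =ᵐ[m] fun x => (μ.rnDeriv m x).toReal) :
    ∃ C τ : ℝ, 0 < C ∧ 0 < τ ∧ ∀ (φ : p.Space) (ψ : M → ℝ), Integrable ψ m → ∀ n : ℕ,
      absCov μ (p.incl φ) (ψ ∘ f^[n]) ≤ C * Real.exp (-τ * n) * ‖φ‖ * ∫ x, |ψ x| ∂m := by
  have := hμ.prob
  obtain ⟨T, hTP, C, τ, hC, hτ, H⟩ := hp.exists_decay hf hμ hmix hh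
  obtain ⟨C₂, hC₂, H₂⟩ := hp.ae_bound
  refine ⟨C₂ * C, τ, by positivity, hτ, fun φ ψ hψ n => ?_⟩
  obtain ⟨g, hg, hgn⟩ := H φ
  -- The density is bounded because it lies in `B`.
  have hψμ : Integrable ψ μ := by
    rw [← integrable_density_mul_iff hμ.ac]
    refine hψ.bdd_mul (c := C₂ * ‖h‖)
      (Measure.measurable_rnDeriv _ _).ennreal_toReal.aestronglyMeasurable ?_
    filter_upwards [hh, H₂ h] with x h1 h2
    rwa [← h1]
  have hψn : Integrable (ψ ∘ f^[n]) μ := (hμ.invariant.iterate n).integrable_comp_of_integrable hψμ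
  have hφψ : Integrable (fun x => p.incl φ x * (ψ ∘ f^[n]) x) μ :=
    hψn.bdd_mul (Lp.stronglyMeasurable _).aestronglyMeasurable (hμ.ac.ae_le (H₂ φ))
  have hb : ∀ᵐ x ∂m, |p.incl ((T ^ n) g) x| ≤ C₂ * C * Real.exp (-τ * n) * ‖φ‖ := by
    filter_upwards [H₂ ((T ^ n) g)] with x hx
    refine hx.trans ?_
    calc C₂ * ‖(T ^ n) g‖ ≤ C₂ * (C * Real.exp (-τ * n) * ‖φ‖) := by
          gcongr
          exact hgn n
      _ = _ := by ring
  have e1 : (∫ x, p.incl φ x * (ψ ∘ f^[n]) x ∂μ) - (∫ x, p.incl φ x ∂μ) * ∫ x, (ψ ∘ f^[n]) x ∂μ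
      = ∫ x, (p.incl φ x - ∫ y, p.incl φ y ∂μ) * (ψ ∘ f^[n]) x ∂μ := by
    simp only [sub_mul]
    rw [integral_sub hφψ (hψn.const_mul _), integral_const_mul]
  have hint : Integrable (fun x => (p.incl φ x - ∫ y, p.incl φ y ∂μ) * (ψ ∘ f^[n]) x) μ := by
    simp only [sub_mul]
    exact hφψ.sub (hψn.const_mul _)
  have hae : (fun x => (μ.rnDeriv m x).toReal *
      ((p.incl φ x - ∫ y, p.incl φ y ∂μ) * (ψ ∘ f^[n]) x))
        =ᵐ[m] fun x => p.incl g x * ψ (f^[n] x) := by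
    filter_upwards [hg] with x hx
    rw [hx, mul_assoc]
    rfl
  have e2 : ∫ x, (p.incl φ x - ∫ y, p.incl φ y ∂μ) * (ψ ∘ f^[n]) x ∂μ
      = ∫ x, p.incl ((T ^ n) g) x * ψ x ∂m := by
    rw [← integral_density_mul hμ.ac, integral_congr_ae hae]
    symm
    refine integral_mul_eq_of_setIntegral_eq (hf.iterate n) (L1.integrable_coeFn _)
      (L1.integrable_coeFn _) (fun s hs => ?_) hψ.aestronglyMeasurable
      (hψ.bdd_mul (Lp.stronglyMeasurable _).aestronglyMeasurable hb)
      (((integrable_density_mul_iff hμ.ac).2 hint).congr hae)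
    rw [hTP, setIntegral_perronFrobenius_iterate hf _ _ hs]
  rw [absCov, e1, e2, ← integral_const_mul]
  refine norm_integral_le_of_norm_le (f := fun x => p.incl ((T ^ n) g) x * ψ x)
    (hψ.abs.const_mul _) ?_
  filter_upwards [hb] with x hx
  rw [norm_mul]
  exact mul_le_mul_of_nonneg_right hx (norm_nonneg _)

end Decay

section Positive

variable {μ : Measure M} {c : ℝ}

/-- The lower bound on the density gives `‖ψ‖_{L¹(m)} ≤ c⁻¹ ‖ψ‖_{L¹(μ)}`, and invariance identifies
the `L¹(μ)` norms of `ψ` and `ψ ∘ f^[n]`. -/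
theorem exists_correlation_le (hp : IsAdapted f m p) (hf : Measure.QuasiMeasurePreserving f m m)
    (hμ : IsACIP f m μ) (hmix : IsMixing f μ) {h : p.Space}
    (hh : p.incl h =ᵐ[m] fun x => (μ.rnDeriv m x).toReal) (hc : 0 < c)
    (hcd : ∀ᵐ x ∂m, ENNReal.ofReal c ≤ μ.rnDeriv m x) :
    ∃ C τ : ℝ, 0 < C ∧ 0 < τ ∧ ∀ (φ : p.Space) (ψ : M → ℝ), Integrable ψ μ → ∀ n : ℕ,
      correlation p μ φ (ψ ∘ f^[n]) ≤ C * Real.exp (-τ * n) := by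
  have := hμ.prob
  obtain ⟨C, τ, hC, hτ, H⟩ := hp.exists_absCov_le hf hμ hmix hh
  refine ⟨C / c, τ, by positivity, hτ, fun φ ψ hψ n => ?_⟩
  have hψd : Integrable (fun x => (μ.rnDeriv m x).toReal * |ψ x|) m :=
    (integrable_density_mul_iff hμ.ac).2 hψ.abs
  have hle : ∀ᵐ x ∂m, |ψ x| ≤ c⁻¹ * ((μ.rnDeriv m x).toReal * |ψ x|) := by
    filter_upwards [hμ.le_density hcd] with x hx
    rw [inv_mul_eq_div, le_div_iff₀ hc, mul_comm]
    gcongr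
  have hψm : Integrable ψ m := (hψd.const_mul c⁻¹).mono'
    (hψ.aestronglyMeasurable.mono_ac (hμ.absolutelyContinuous_of_le_rnDeriv hc hcd)) hle
  have hI : ∫ x, |ψ x| ∂m ≤ c⁻¹ * ∫ x, |ψ x| ∂μ := by
    rw [← integral_density_mul hμ.ac, ← integral_const_mul]
    exact integral_mono_ae hψm.abs (hψd.const_mul _) hle
  have hinv : ∫ x, |(ψ ∘ f^[n]) x| ∂μ = ∫ x, |ψ x| ∂μ := by
    have hi := hμ.invariant.iterate n
    have h2 : AEStronglyMeasurable (fun x => |ψ x|) (μ.map f^[n]) := by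
      rw [hi.map_eq]
      exact hψ.abs.aestronglyMeasurable
    have := integral_map hi.measurable.aemeasurable h2
    rw [hi.map_eq] at this
    exact this.symm
  rw [correlation, hinv, one_div, inv_mul_eq_div]
  -- A vanishing denominator is covered too, since division by zero gives zero.
  refine div_le_of_le_mul₀ (by positivity) (by positivity) ((H φ ψ hψm n).trans ?_)
  calc C * Real.exp (-τ * n) * ‖φ‖ * ∫ x, |ψ x| ∂m
      ≤ C * Real.exp (-τ * n) * ‖φ‖ * (c⁻¹ * ∫ x, |ψ x| ∂μ) := by gcongr
    _ = _ := by ring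

end Positive

end IsAdapted

/-! ### Azuma-Hoeffding bounds for reverse martingale differences. -/

section Azuma

variable {M : Type*} [MeasurableSpace M] {μ : Measure M} {f : M → M}

theorem ae_abs_sum_iterate_le (hf : MeasurePreserving f μ μ) {ξ : M → ℝ} {a : ℝ}
    (hξ : ∀ᵐ x ∂μ, |ξ x| ≤ a) (n : ℕ) :
    ∀ᵐ x ∂μ, |∑ i ∈ Finset.range n, ξ (f^[i] x)| ≤ n * a := by
  have h : ∀ᵐ x ∂μ, ∀ i : ℕ, |ξ (f^[i] x)| ≤ a :=
    ae_all_iff.2 fun i => (hf.iterate i).quasiMeasurePreserving.ae hξ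
  filter_upwards [h] with x hx
  refine (Finset.abs_sum_le_sum_abs _ _).trans ((Finset.sum_le_sum fun i _ => hx i).trans ?_)
  simp

variable [IsProbabilityMeasure μ]

theorem integrable_exp_sum_iterate (hf : MeasurePreserving f μ μ) {ξ : M → ℝ} {a : ℝ}
    (hm : Measurable ξ) (hξ : ∀ᵐ x ∂μ, |ξ x| ≤ a) (t : ℝ) (n : ℕ) :
    Integrable (fun x => Real.exp (t * ∑ i ∈ Finset.range n, ξ (f^[i] x))) μ := by
  have hms : Measurable fun x => Real.exp (t * ∑ i ∈ Finset.range n, ξ (f^[i] x)) :=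
    ((Finset.measurable_sum _ fun i _ => hm.comp (hf.measurable.iterate i)).const_mul t).exp
  refine Integrable.of_bound hms.aestronglyMeasurable (Real.exp (|t| * (n * a))) ?_
  filter_upwards [ae_abs_sum_iterate_le hf hξ n] with x hx
  rw [Real.norm_of_nonneg (Real.exp_nonneg _), Real.exp_le_exp]
  refine (le_abs_self _).trans ?_
  rw [abs_mul]
  gcongr

/-- The Azuma-Hoeffding bound on the moment generating function of a sum of reverse martingale
differences. -/
theorem integral_exp_sum_iterate_le (hf : MeasurePreserving f μ μ) {ξ : M → ℝ} {a : ℝ} (ha : 0 < a)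
    (hm : Measurable ξ) (hξ : ∀ᵐ x ∂μ, |ξ x| ≤ a)
    (horth : ∀ (ψ : M → ℝ) (b : ℝ), Measurable ψ → (∀ᵐ x ∂μ, |ψ x| ≤ b) →
      ∫ x, ξ x * ψ (f x) ∂μ = 0) (t : ℝ) (n : ℕ) :
    ∫ x, Real.exp (t * ∑ i ∈ Finset.range n, ξ (f^[i] x)) ∂μ
      ≤ Real.exp (n * (t ^ 2 * a ^ 2 / 2)) := by
  induction n with
  | zero => simp
  | succ n ih =>
    -- The term `i = 0` is split off: the remaining `n` terms form a function of `f x`, to which `ξ`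
    -- is orthogonal.
    set E : M → ℝ := fun x => Real.exp (t * ∑ i ∈ Finset.range n, ξ (f^[i] x)) with hE
    have hEm : Measurable E :=
      ((Finset.measurable_sum _ fun i _ => hm.comp (hf.measurable.iterate i)).const_mul t).exp
    have hEi : Integrable E μ := integrable_exp_sum_iterate hf hm hξ t n
    have hEf : Integrable (fun x => E (f x)) μ := hf.integrable_comp_of_integrable hEi
    have hEb : ∀ᵐ x ∂μ, |E x| ≤ Real.exp (|t| * (n * a)) := by
      filter_upwards [ae_abs_sum_iterate_le hf hξ n] with x hx
      rw [abs_of_nonneg (Real.exp_nonneg _), Real.exp_le_exp]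
      refine (le_abs_self _).trans ?_
      rw [abs_mul]
      gcongr
    have hξE : Integrable (fun x => ξ x * E (f x)) μ :=
      hEf.bdd_mul hm.aestronglyMeasurable hξ
    -- By convexity the exponential lies below its chord on `[-a, a]`; the linear part of the chord
    -- integrates to zero against `E ∘ f`.
    have hle : ∀ᵐ x ∂μ, Real.exp (t * ∑ i ∈ Finset.range (n + 1), ξ (f^[i] x))
        ≤ Real.cosh (t * a) * E (f x) + Real.sinh (t * a) / a * (ξ x * E (f x)) := by
      filter_upwards [hξ] with x hx
      have h1 : |ξ x / a| ≤ 1 := by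
        rw [abs_div, abs_of_pos ha]
        exact (div_le_one ha).2 hx
      have h2 := Real.exp_mul_le_cosh_add_mul_sinh h1 (t * a)
      have h3 : ξ x / a * (t * a) = t * ξ x := by field_simp
      rw [h3] at h2
      rw [Finset.sum_range_succ', mul_add, Real.exp_add, mul_comm]
      calc Real.exp (t * ξ (f^[0] x)) * Real.exp (t * ∑ i ∈ Finset.range n, ξ (f^[i + 1] x))
          ≤ (Real.cosh (t * a) + ξ x / a * Real.sinh (t * a)) * E (f x) := by
            simp only [hE, ← Function.iterate_succ_apply]
            gcongr
            exact h2
        _ = _ := by ring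
    have hinv : ∫ x, E (f x) ∂μ = ∫ x, E x ∂μ := by
      have h2 : AEStronglyMeasurable E (μ.map f) := hEm.aestronglyMeasurable
      have := integral_map hf.measurable.aemeasurable h2
      rw [hf.map_eq] at this
      exact this.symm
    calc ∫ x, Real.exp (t * ∑ i ∈ Finset.range (n + 1), ξ (f^[i] x)) ∂μ
        ≤ ∫ x, (Real.cosh (t * a) * E (f x) + Real.sinh (t * a) / a * (ξ x * E (f x))) ∂μ :=
          integral_mono_ae (integrable_exp_sum_iterate hf hm hξ t (n + 1))
            ((hEf.const_mul _).add (hξE.const_mul _)) hle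
      _ = Real.cosh (t * a) * ∫ x, E x ∂μ := by
          rw [integral_add (hEf.const_mul _) (hξE.const_mul _), integral_const_mul,
            integral_const_mul, horth E _ hEm hEb, hinv, mul_zero, add_zero]
      _ ≤ Real.exp ((t * a) ^ 2 / 2) * Real.exp (n * (t ^ 2 * a ^ 2 / 2)) := by
          have := Real.cosh_le_exp_half_sq (t * a)
          gcongr
      _ = _ := by
          rw [← Real.exp_add]
          push_cast
          ring_nf

/-- The Azuma-Hoeffding inequality for a sum of reverse martingale differences. -/
theorem measure_abs_sum_iterate_ge_le (hf : MeasurePreserving f μ μ) {ξ : M → ℝ} {a : ℝ}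
    (ha : 0 < a) (hm : Measurable ξ) (hξ : ∀ᵐ x ∂μ, |ξ x| ≤ a)
    (horth : ∀ (ψ : M → ℝ) (b : ℝ), Measurable ψ → (∀ᵐ x ∂μ, |ψ x| ≤ b) →
      ∫ x, ξ x * ψ (f x) ∂μ = 0) {t : ℝ} (ht : 0 ≤ t) (s : ℝ) (n : ℕ) :
    μ.real {x | s ≤ |∑ i ∈ Finset.range n, ξ (f^[i] x)|}
      ≤ 2 * Real.exp (-t * s + n * (t ^ 2 * a ^ 2 / 2)) := by
  have one : ∀ ξ : M → ℝ, Measurable ξ → (∀ᵐ x ∂μ, |ξ x| ≤ a) →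
      (∀ (ψ : M → ℝ) (b : ℝ), Measurable ψ → (∀ᵐ x ∂μ, |ψ x| ≤ b) →
        ∫ x, ξ x * ψ (f x) ∂μ = 0) →
      μ.real {x | s ≤ ∑ i ∈ Finset.range n, ξ (f^[i] x)}
        ≤ Real.exp (-t * s + n * (t ^ 2 * a ^ 2 / 2)) := by
    intro ξ hm hξ horth
    refine (ProbabilityTheory.measure_ge_le_exp_mul_mgf s ht
      (integrable_exp_sum_iterate hf hm hξ t n)).trans ?_
    rw [Real.exp_add]
    gcongr
    exact integral_exp_sum_iterate_le hf ha hm hξ horth t n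
  have h1 := one ξ hm hξ horth
  have h2 := one (fun x => -ξ x) hm.neg (by simpa using hξ) fun ψ b hψ hb => by
    simp only [neg_mul]
    rw [integral_neg, horth ψ b hψ hb, neg_zero]
  have hsub : {x | s ≤ |∑ i ∈ Finset.range n, ξ (f^[i] x)|}
      ⊆ {x | s ≤ ∑ i ∈ Finset.range n, ξ (f^[i] x)}
        ∪ {x | s ≤ ∑ i ∈ Finset.range n, -ξ (f^[i] x)} := fun x hx => by
    rcases le_abs.1 (show s ≤ |∑ i ∈ Finset.range n, ξ (f^[i] x)| from hx) with h | h
    · exact Or.inl h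
    · right
      change s ≤ _
      rwa [Finset.sum_neg_distrib]
  calc _ ≤ _ := measureReal_mono hsub
    _ ≤ _ := measureReal_union_le _ _
    _ ≤ _ := by linarith

/-- Large deviations of a bounded function that is a reverse martingale difference up to a bounded
coboundary and a small error. -/
theorem measure_average_gt_le (hf : MeasurePreserving f μ μ) {ξ χ r φ : M → ℝ} {A ε : ℝ}
    (hA : 0 < A) (hε : 0 < ε) (hm : Measurable ξ) (hξ : ∀ᵐ x ∂μ, |ξ x| ≤ 2 * A)
    (hχ : ∀ᵐ x ∂μ, |χ x| ≤ A) (hr : ∀ᵐ x ∂μ, |r x| ≤ ε / 4)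
    (horth : ∀ (ψ : M → ℝ) (b : ℝ), Measurable ψ → (∀ᵐ x ∂μ, |ψ x| ≤ b) →
      ∫ x, ξ x * ψ (f x) ∂μ = 0)
    (hφ : ∀ᵐ x ∂μ, φ x = ξ x + χ (f x) - χ x + r x) {n : ℕ} (hn : 1 ≤ n) :
    μ.real {x | ε < |(1 / (n : ℝ)) * ∑ i ∈ Finset.range n, φ (f^[i] x)|}
      ≤ 2 * Real.exp (ε / (2 * A)) * Real.exp (-(ε ^ 2 / (16 * A ^ 2)) * n) := by
  have hn0 : (0 : ℝ) < n := by exact_mod_cast hn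
  have hφ' : ∀ᵐ x ∂μ, ∀ i : ℕ, φ (f^[i] x)
      = ξ (f^[i] x) + χ (f (f^[i] x)) - χ (f^[i] x) + r (f^[i] x) :=
    ae_all_iff.2 fun i => (hf.iterate i).quasiMeasurePreserving.ae hφ
  -- The coboundary telescopes to at most `2 * A` and the errors add up to at most `n * ε / 4`; the
  -- sum of the `ξ` has to supply the rest.
  have hsub : {x | ε < |(1 / (n : ℝ)) * ∑ i ∈ Finset.range n, φ (f^[i] x)|}
      ≤ᵐ[μ] {x | 3 * n * ε / 4 - 2 * A ≤ |∑ i ∈ Finset.range n, ξ (f^[i] x)|} := by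
    filter_upwards [hφ', ae_abs_sum_iterate_le hf hr n, hχ,
      (hf.iterate n).quasiMeasurePreserving.ae hχ] with x h1 h2 h3 h4 h5
    change ε < |(1 / (n : ℝ)) * ∑ i ∈ Finset.range n, φ (f^[i] x)| at h5
    change _ ≤ |∑ i ∈ Finset.range n, ξ (f^[i] x)|
    have e : ∑ i ∈ Finset.range n, φ (f^[i] x) = ∑ i ∈ Finset.range n, ξ (f^[i] x)
        + (χ (f^[n] x) - χ x) + ∑ i ∈ Finset.range n, r (f^[i] x) := by
      have h6 := Finset.sum_range_sub (fun i => χ (f^[i] x)) n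
      simp only [Function.iterate_succ_apply', Function.iterate_zero, id_eq] at h6
      rw [← h6, ← Finset.sum_add_distrib, ← Finset.sum_add_distrib]
      exact Finset.sum_congr rfl fun i _ => by rw [h1 i]; ring
    rw [abs_mul, abs_of_pos (by positivity), one_div, inv_mul_eq_div, lt_div_iff₀ hn0, e] at h5
    have h7 := abs_add_le (∑ i ∈ Finset.range n, ξ (f^[i] x) + (χ (f^[n] x) - χ x))
      (∑ i ∈ Finset.range n, r (f^[i] x))
    have h8 := abs_add_le (∑ i ∈ Finset.range n, ξ (f^[i] x)) (χ (f^[n] x) - χ x)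
    have h9 := abs_sub (χ (f^[n] x)) (χ x)
    linarith
  -- With `t = ε / (4 * A ^ 2)` and increments bounded by `2 * A`, the linear rate `-3ε²/(16A²)`
  -- outweighs the quadratic one `2ε²/(16A²)`.
  have ht : 0 ≤ ε / (4 * A ^ 2) := by positivity
  calc _ ≤ _ := ENNReal.toReal_mono (measure_ne_top _ _) (measure_mono_ae hsub)
    _ ≤ _ := measure_abs_sum_iterate_ge_le hf (by positivity : 0 < 2 * A) hm hξ horth ht _ n
    _ = _ := by
      rw [mul_assoc 2 (Real.exp _), ← Real.exp_add]
      congr 2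
      field_simp
      ring

end Azuma

/-! ### Exponential large deviations. -/

namespace IsAdapted

variable {M : Type*} [MeasurableSpace M] {m : Measure M} [IsProbabilityMeasure m] {f : M → M}
  {p : ExtSeminorm (M →₁[m] ℝ)} {μ : Measure M} {c : ℝ}

/-- For `G ∈ B`, the function `G / h - (P G / h) ∘ f`, where `h = dμ/dm`, is orthogonal to bounded
functions of the form `ψ ∘ f`. -/
theorem integral_transfer_coboundary_mul_eq_zero (hf : Measure.QuasiMeasurePreserving f m m)
    (hμ : IsACIP f m μ) (hc : 0 < c) (hcd : ∀ᵐ x ∂m, ENNReal.ofReal c ≤ μ.rnDeriv m x)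
    (G : M →₁[m] ℝ) {ψ : M → ℝ} {b : ℝ} (hψ : Measurable ψ) (hb : ∀ᵐ x ∂μ, |ψ x| ≤ b) :
    ∫ x, (G x / (μ.rnDeriv m x).toReal
      - perronFrobenius f m G (f x) / (μ.rnDeriv m (f x)).toReal) * ψ (f x) ∂μ = 0 := by
  have := hμ.prob
  have hb' : ∀ᵐ x ∂m, |ψ x| ≤ b := (hμ.absolutelyContinuous_of_le_rnDeriv hc hcd).ae_le hb
  have hbf : ∀ᵐ x ∂m, |ψ (f x)| ≤ b := hf.ae hb'
  have cancel : ∀ u v : M → ℝ, (fun x => (μ.rnDeriv m x).toReal *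
      (u x / (μ.rnDeriv m x).toReal * v x)) =ᵐ[m] fun x => u x * v x := fun u v => by
    filter_upwards [hμ.le_density hcd] with x hx
    have : (μ.rnDeriv m x).toReal ≠ 0 := (hc.trans_le hx).ne'
    field_simp
  set PG := perronFrobenius f m G with hPG
  have i1 : Integrable (fun x => G x * ψ (f x)) m :=
    (L1.integrable_coeFn G).mul_bdd (hψ.comp hf.measurable).aestronglyMeasurable hbf
  have i2 : Integrable (fun x => PG x * ψ x) m :=
    (L1.integrable_coeFn PG).mul_bdd hψ.aestronglyMeasurable hb'
  have j1 : Integrable (fun x => G x / (μ.rnDeriv m x).toReal * ψ (f x)) μ :=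
    (integrable_density_mul_iff hμ.ac).1 (i1.congr (cancel G fun x => ψ (f x)).symm)
  have j2 : Integrable (fun x => PG x / (μ.rnDeriv m x).toReal * ψ x) μ :=
    (integrable_density_mul_iff hμ.ac).1 (i2.congr (cancel PG ψ).symm)
  have j3 : Integrable (fun x => PG (f x) / (μ.rnDeriv m (f x)).toReal * ψ (f x)) μ :=
    hμ.invariant.integrable_comp_of_integrable j2
  -- The factor `dμ/dm` cancels the quotients, after using invariance in the second integral; what
  -- remains is the duality `∫ G (ψ ∘ f) dm = ∫ (P G) ψ dm`.
  have e1 : ∫ x, G x / (μ.rnDeriv m x).toReal * ψ (f x) ∂μ = ∫ x, G x * ψ (f x) ∂m := by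
    rw [← integral_density_mul hμ.ac, integral_congr_ae (cancel G fun x => ψ (f x))]
  have e2 : ∫ x, PG (f x) / (μ.rnDeriv m (f x)).toReal * ψ (f x) ∂μ = ∫ x, PG x * ψ x ∂m := by
    rw [← integral_congr_ae (cancel PG ψ), integral_density_mul hμ.ac]
    have h2 : AEStronglyMeasurable (fun x => PG x / (μ.rnDeriv m x).toReal * ψ x) (μ.map f) := by
      rw [hμ.invariant.map_eq]
      exact j2.aestronglyMeasurable
    have := integral_map hμ.invariant.measurable.aemeasurable h2
    rw [hμ.invariant.map_eq] at this
    exact this.symm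
  simp only [sub_mul]
  rw [integral_sub j1 j3, e1, e2, sub_eq_zero]
  exact (integral_mul_eq_of_setIntegral_eq hf (L1.integrable_coeFn G) (L1.integrable_coeFn PG)
    (fun s hs => setIntegral_perronFrobenius hf G hs) hψ.aestronglyMeasurable i2 i1).symm

/-- With `G = ∑_{i<N} Tⁱ g` one has `g = G - T G + T^N g`. Dividing by `h` and setting `χ = T G / h`
gives `φ - ∫ φ dμ = (G / h - χ ∘ f) + (χ ∘ f - χ) + T^N g / h`: a reverse martingale difference, a
coboundary and a remainder. Decay in `B` makes the remainder at most `ε / 4` for an `N` that is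
uniform over `‖φ‖ ≤ K`. -/
theorem exists_largeDeviation_le (hp : IsAdapted f m p)
    (hf : Measure.QuasiMeasurePreserving f m m)
    (hμ : IsACIP f m μ) (hmix : IsMixing f μ) {h : p.Space}
    (hh : p.incl h =ᵐ[m] fun x => (μ.rnDeriv m x).toReal) (hc : 0 < c)
    (hcd : ∀ᵐ x ∂m, ENNReal.ofReal c ≤ μ.rnDeriv m x) {ε : ℝ} (hε : 0 < ε) {K : ℝ} (hK : 0 < K) :
    ∃ C τ : ℝ, 0 < C ∧ 0 < τ ∧ ∀ φ : p.Space, ‖φ‖ ≤ K → ∀ n : ℕ, 1 ≤ n →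
      largeDeviation f μ (p.incl φ) ε n ≤ C * Real.exp (-τ * n) := by
  have := hμ.prob
  obtain ⟨T, hTP, C, τ, hC, hτ, H⟩ := hp.exists_decay hf hμ hmix hh
  obtain ⟨C₂, hC₂, H₂⟩ := hp.ae_bound
  obtain ⟨N, hN⟩ : ∃ N : ℕ, C₂ * (C * Real.exp (-τ * N) * K) / c ≤ ε / 4 := by
    have h1 : Tendsto (fun N : ℕ => -τ * (N : ℝ)) atTop atBot :=
      tendsto_natCast_atTop_atTop.const_mul_atTop_of_neg (neg_lt_zero.2 hτ)
    have h2 := (((Real.tendsto_exp_atBot.comp h1).const_mul C).mul_const K).const_mul C₂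
      |>.div_const c
    simp only [mul_zero, zero_mul, zero_div] at h2
    exact (h2.eventually (ge_mem_nhds (show (0 : ℝ) < ε / 4 by positivity))).exists
  -- A common bound for `G / h` and `T G / h`: `N` terms of norm at most `C * K`, embedded in `L^∞`
  -- and divided by a density at least `c`. The `1` keeps it positive when `N = 0`.
  set A : ℝ := C₂ * (N * (C * K)) / c + 1 with hA
  have hA0 : 0 < A := by positivity
  refine ⟨2 * Real.exp (ε / (2 * A)), ε ^ 2 / (16 * A ^ 2), by positivity, by positivity,
    fun φ hφ n hn => ?_⟩
  obtain ⟨g, hg, hgn⟩ := H φ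
  have quot : ∀ (u : p.Space) (B : ℝ), ‖u‖ ≤ B →
      ∀ᵐ x ∂μ, |p.incl u x / (μ.rnDeriv m x).toReal| ≤ C₂ * B / c := fun u B hu => by
    refine hμ.ac.ae_le ?_
    filter_upwards [hμ.le_density hcd, H₂ u] with x hx hux
    rw [abs_div, abs_of_pos (hc.trans_le hx)]
    have : C₂ * ‖u‖ ≤ C₂ * B := by gcongr
    exact div_le_div₀ ((abs_nonneg _).trans (hux.trans this)) (hux.trans this) hc hx
  have hgn' : ∀ i : ℕ, ‖(T ^ i) g‖ ≤ C * K := fun i => (hgn i).trans (by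
    have : Real.exp (-τ * i) ≤ 1 := Real.exp_le_one_iff.2 (by
      rw [neg_mul, neg_nonpos]
      positivity)
    calc C * Real.exp (-τ * i) * ‖φ‖ ≤ C * 1 * K := by gcongr
      _ = _ := by ring)
  set G : p.Space := ∑ i ∈ Finset.range N, (T ^ i) g with hG
  have hTG : T G = ∑ i ∈ Finset.range N, (T ^ (i + 1)) g := by
    rw [hG, map_sum]
    exact Finset.sum_congr rfl fun i _ => by rw [pow_succ']; rfl
  have hGn : ‖G‖ ≤ N * (C * K) :=
    (norm_sum_le_of_le _ fun i _ => hgn' i).trans (by simp)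
  have hTGn : ‖T G‖ ≤ N * (C * K) := by
    rw [hTG]
    exact (norm_sum_le_of_le _ fun i _ => hgn' (i + 1)).trans (by simp)
  have hsum : g = G - T G + (T ^ N) g := by
    have := Finset.sum_range_sub' (fun i => (T ^ i) g) N
    rw [hTG, hG, ← Finset.sum_sub_distrib, this]
    simp
  have hPG : p.incl (T G) = perronFrobenius f m (p.incl G) := by
    have := hTP 1 G
    rwa [pow_one] at this
  set d : M → ℝ := fun x => (μ.rnDeriv m x).toReal with hd
  have hdm : Measurable d := (Measure.measurable_rnDeriv _ _).ennreal_toReal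
  have hqm : ∀ u : p.Space, Measurable fun x => p.incl u x / d x := fun u =>
    (Lp.stronglyMeasurable _).measurable.div hdm
  have bU := quot G _ hGn
  have bW := quot (T G) _ hTGn
  have key := measure_average_gt_le hμ.invariant
    (ξ := fun x => p.incl G x / d x - p.incl (T G) (f x) / d (f x))
    (χ := fun x => p.incl (T G) x / d x) (r := fun x => p.incl ((T ^ N) g) x / d x)
    (φ := fun x => p.incl φ x - ∫ y, p.incl φ y ∂μ) (A := A) (ε := ε) hA0 hε
    ((hqm G).sub ((hqm (T G)).comp hf.measurable)) ?_ ?_ ?_ ?_ ?_ hn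
  · refine le_of_eq_of_le ?_ key
    have hn0 : (n : ℝ) ≠ 0 := by positivity
    rw [largeDeviation]
    congr 1
    ext x
    simp only [Finset.sum_sub_distrib, Finset.sum_const, Finset.card_range, nsmul_eq_mul,
      mul_sub]
    rw [one_div, inv_mul_cancel_left₀ hn0]
  · filter_upwards [bU, hμ.invariant.quasiMeasurePreserving.ae bW] with x h1 h2
    have := abs_sub (p.incl G x / d x) (p.incl (T G) (f x) / d (f x))
    linarith
  · filter_upwards [bW] with x h1
    linarith
  · refine (quot ((T ^ N) g) (C * Real.exp (-τ * N) * K) ((hgn N).trans ?_)).mono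
      fun x hx => hx.trans hN
    gcongr
  · intro ψ b hψ hb
    rw [hPG]
    exact integral_transfer_coboundary_mul_eq_zero hf hμ hc hcd (p.incl G) hψ hb
  · refine hμ.ac.ae_le ?_
    have hs : p.incl g = p.incl G - p.incl (T G) + p.incl ((T ^ N) g) := by
      rw [← map_sub, ← map_add, ← hsum]
    filter_upwards [hg, hμ.le_density hcd,
      Lp.coeFn_add (p.incl G - p.incl (T G)) (p.incl ((T ^ N) g)),
      Lp.coeFn_sub (p.incl G) (p.incl (T G))] with x h1 h2 h3 h4
    have hdx : d x ≠ 0 := (hc.trans_le h2).ne'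
    rw [← hs, Pi.add_apply, h4, Pi.sub_apply, h1] at h3
    rw [← mul_right_inj' hdx, h3]
    field_simp
    ring

end IsAdapted

theorem mainTheorem8 {M : Type*} [MeasurableSpace M] (m : Measure M) [IsProbabilityMeasure m]
    (f : M → M) (hf : Measure.QuasiMeasurePreserving f m m)
    (p : ExtSeminorm (M →₁[m] ℝ)) [Nontrivial p.Space] (hp : IsAdapted f m p) :
    -- there is an absolutely continuous invariant probability measure with density in `B`
    (∃ μ : Measure M, IsACIP f m μ ∧
      ∃ h : p.Space, p.incl h =ᵐ[m] fun x => (μ.rnDeriv m x).toReal) ∧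
    ∀ μ : Measure M, IsACIP f m μ → IsMixing f μ →
      -- without a lower bound on the density: exponential decay against `L¹(m)`
      ((∀ ν : Measure M, IsACIP f m ν → ν ≪ μ) →
        ∃ C τ : ℝ, 0 < C ∧ 0 < τ ∧ ∀ (φ : p.Space) (ψ : M → ℝ), Integrable ψ m → ∀ n : ℕ,
          absCov μ (p.incl φ) (ψ ∘ f^[n]) ≤
            C * Real.exp (-τ * n) * ‖φ‖ * ∫ x, |ψ x| ∂m) ∧
      -- density bounded below: exponential decay against `L¹(μ)`, exponential large deviations
      ((∃ c : ℝ, 0 < c ∧ ∀ᵐ x ∂m, ENNReal.ofReal c ≤ μ.rnDeriv m x) →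
        (∃ C τ : ℝ, 0 < C ∧ 0 < τ ∧ ∀ (φ : p.Space) (ψ : M → ℝ), Integrable ψ μ → ∀ n : ℕ,
          correlation p μ φ (ψ ∘ f^[n]) ≤ C * Real.exp (-τ * n)) ∧
        (∀ ε : ℝ, 0 < ε → ∀ K : ℝ, 0 < K → ∃ C τ : ℝ, 0 < C ∧ 0 < τ ∧
          ∀ φ : p.Space, ‖φ‖ ≤ K → ∀ n : ℕ, 1 ≤ n →
            largeDeviation f μ (p.incl φ) ε n ≤ C * Real.exp (-τ * n))) := by
  refine ⟨hp.exists_acip hf, fun μ hμ hmix => ⟨fun hu => ?_, ?_⟩⟩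
  · obtain ⟨h, hh⟩ := hp.density_mem hf hμ hmix hu
    exact hp.exists_absCov_le hf hμ hmix hh
  · rintro ⟨c, hc, hcd⟩
    -- The lower bound gives `m ≪ μ`, so `μ` dominates every acip.
    obtain ⟨h, hh⟩ := hp.density_mem hf hμ hmix fun ν hν =>
      hν.ac.trans (hμ.absolutelyContinuous_of_le_rnDeriv hc hcd)
    exact ⟨hp.exists_correlation_le hf hμ hmix hh hc hcd,
      fun ε hε K hK => hp.exists_largeDeviation_le hf hμ hmix hh hc hcd hε hK⟩
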